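/- Let $W$ be a binary-input symmetric memoryless channel with input alphabet $\{0,1\}$ and transition densities $W(y\mid 0),W(y\mid 1)$ with respect to a $\sigma$-finite measure $\lambda$ on the output space $Y$, and with Bhattacharyya parameter $Z(W)=\int\sqrt{W(y\mid 0)W(y\mid 1)}\,d\lambda(y)$ satisfying $0<Z(W)<1$ (that is, $W$ is neither noiseless nor completely noisy). Symmetric means that some measurable involution of $Y$ carries the output distribution for input $0$ to the one for input $1$. Let $n\ge 0$, $N=2^n$, and $G=F^{\otimes n}$ with $F=\begin{pmatrix}1&0\\1&1\end{pmatrix}$ over $\mathbb F_2$. For $0\le i<N$ let $W_N^{(i)}$ be the bit-channel with input $u_i$, output $(y,u_0,\dots,u_{i-1})$ and transition density $$W_N^{(i)}(y,u_0^{i-1}\mid u_i)=2^{-(N-1)}\sum_{u_{i+1},\dots,u_{N-1}\in\{0,1\}}\ \prod_{k=0}^{N-1}W\big(y_k\mid (uG)_k\big).$$ Let $\mathcal A\subseteq\{0,\dots,N-1\}$ be a non-empty information set of a polar code for $W$: $\mathcal A$ consists of $|\mathcal A|$ indices with the smallest Bhattacharyya parameters, i.e. $Z(W_N^{(i)})\le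 Z(W_N^{(j)})$ for all $i\in\mathcal A$, $j\notin\mathcal A$ (ties are broken arbitrarily). The factor graph of the code has variable nodes $v(r,c)$ ($0\le r<N$, $0\le c\le n$) and check nodes $c(r,c)$ ($0\le r<N$, $0\le c<n$). The check node $c(r,c)$ is adjacent to $v(r,c)$ and $v(r,c+1)$ and, if the binary digit of $r$ of weight $2^{n-1-c}$ is $0$, also to $v(r+2^{n-1-c},c)$. A stopping set is a non-empty set $S$ of variable nodes such that every check node adjacent to a member of $S$ is adjacent to at least two members of $S$. Its information nodes are the indices $r$ with $v(r,0)\in S$, and its observed nodes are the indices $r$ with $v(r,n)\in S$. For each $i$ there is exactly one stopping set $ST(i)$ whose only information node is $i$; let $f(i)$ be the number of its observed nodes. An $MVSS(\mathcal A)$ is a set of smallest size among the sets of observed nodes of those stopping sets whose set of information nodes is exactly $\mathcal A$. Then an $MVSS(\mathcal A)$ exists, and every $MVSS(\mathcal A)$ satisfies $$|MVSS(\mathcal A)|=\min_{i\in\mathcal A}f(i).$$ -/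

import Mathlib

open MeasureTheory

noncomputable section

namespace Polar

/-! ### The kernel matrix and the encoding matrix -/

/-- The kernel `F = [1 0; 1 1]` over the binary field. -/
def kernelMatrix : Matrix (Fin 2) (Fin 2) (ZMod 2) := !![1, 0; 1, 1]

/-- Identification of `Fin 2 × Fin (2 ^ n)` with `Fin (2 ^ (n + 1))` by `(a, b) ↦ b + 2 ^ n * a`
(block index first, as in the usual matrix of a Kronecker product). -/
def blockEquiv (n : ℕ) : Fin 2 × Fin (2 ^ n) ≃ Fin (2 ^ (n + 1)) :=
  finProdFinEquiv.trans (finCongr (by rw [pow_succ, mul_comm]))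

/-- The `n`-th Kronecker power `F ⊗ ⋯ ⊗ F` of the kernel: the encoding matrix `G`. -/
def encodingMatrix : (n : ℕ) → Matrix (Fin (2 ^ n)) (Fin (2 ^ n)) (ZMod 2)
  | 0 => 1
  | n + 1 => Matrix.reindex (blockEquiv n) (blockEquiv n)
      (Matrix.kroneckerMap (· * ·) kernelMatrix (encodingMatrix n))

/-- The encoding map `u ↦ x = u G`. -/
def encode (n : ℕ) (u : Fin (2 ^ n) → ZMod 2) : Fin (2 ^ n) → ZMod 2 :=
  Matrix.vecMul u (encodingMatrix n)

/-! ### Channels, bit-channels and polar codes -/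

/-- A channel with input alphabet `{0, 1}` and output space `Y`, given by its transition
densities `W(y | b)` with respect to a σ-finite reference measure on `Y` (counting measure for
a discrete channel, Lebesgue measure for, e.g., the Gaussian channel). -/
structure BinaryChannel (Y : Type*) [MeasurableSpace Y] where
  ref : Measure Y
  sigmaFinite_ref : SigmaFinite ref
  density : ZMod 2 → Y → ℝ
  measurable_density : ∀ b, Measurable (density b)
  density_nonneg : ∀ b y, 0 ≤ density b y
  integral_density : ∀ b, ∫ y, density b y ∂ref = 1

namespace BinaryChannel

variable {Y : Type*} [MeasurableSpace Y]

/-- The output distribution of the channel when the input is `b`. -/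
def law (W : BinaryChannel Y) (b : ZMod 2) : Measure Y :=
  W.ref.withDensity fun y => ENNReal.ofReal (W.density b y)

/-- The channel is symmetric: an involution of the output space exchanges the output
distributions of the two inputs. -/
def IsSymmetric (W : BinaryChannel Y) : Prop :=
  ∃ σ : Y → Y, Measurable σ ∧ Function.Involutive σ ∧ (W.law 0).map σ = W.law 1

/-- The Bhattacharyya parameter `Z(W) = ∫ √(W(y | 0) W(y | 1)) dy`. -/
def bhattacharyya (W : BinaryChannel Y) : ℝ :=
  ∫ y, Real.sqrt (W.density 0 y * W.density 1 y) ∂W.ref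

/-- Transition density of the `i`-th bit-channel of length `N = 2 ^ n`: for input `b`, received
word `y` and past `p = (u_0, …, u_{i-1})`, this is
`2^{-(N-1)} ∑ ∏_k W(y_k | (u G)_k)`, the sum being over all `u` with `u_i = b` and past `p`. -/
def bitDensity (W : BinaryChannel Y) (n : ℕ) (i : Fin (2 ^ n)) (b : ZMod 2)
    (z : (Fin (2 ^ n) → Y) × ({j : Fin (2 ^ n) // j < i} → ZMod 2)) : ℝ :=
  ((2 : ℝ) ^ (2 ^ n - 1))⁻¹ *
    ∑ u : Fin (2 ^ n) → ZMod 2 with u i = b ∧ (fun j : {j : Fin (2 ^ n) // j < i} => u j) = z.2,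
      ∏ k, W.density (encode n u k) (z.1 k)

theorem integrable_density (W : BinaryChannel Y) (b : ZMod 2) :
    Integrable (W.density b) W.ref := by
  by_contra h
  have := W.integral_density b
  rw [integral_undef h] at this
  exact zero_ne_one this

theorem integrable_prod_density (W : BinaryChannel Y) (n : ℕ) (x : Fin (2 ^ n) → ZMod 2) :
    Integrable (fun y : Fin (2 ^ n) → Y => ∏ k, W.density (x k) (y k))
      (Measure.pi fun _ => W.ref) := by
  have := W.sigmaFinite_ref
  exact Integrable.fintype_prod (f := fun k => W.density (x k)) fun k => W.integrable_density _

theorem integral_prod_density (W : BinaryChannel Y) (n : ℕ) (x : Fin (2 ^ n) → ZMod 2) :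
    ∫ y : Fin (2 ^ n) → Y, ∏ k, W.density (x k) (y k) ∂(Measure.pi fun _ => W.ref) = 1 := by
  have := W.sigmaFinite_ref
  rw [integral_fintype_prod_eq_prod (f := fun k => W.density (x k))]
  simp [W.integral_density]

theorem measurable_bitDensity (W : BinaryChannel Y) (n : ℕ) (i : Fin (2 ^ n)) (b : ZMod 2) :
    Measurable (W.bitDensity n i b) := by
  refine measurable_from_prod_countable_left fun p => ?_
  simp only [bitDensity]
  refine Measurable.const_mul ?_ _
  refine Finset.measurable_fun_sum _ fun u _ => ?_
  exact Finset.measurable_fun_prod _ fun k _ =>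
    (W.measurable_density _).comp (measurable_pi_apply k)

theorem bitDensity_nonneg (W : BinaryChannel Y) (n : ℕ) (i : Fin (2 ^ n)) (b : ZMod 2)
    (z : (Fin (2 ^ n) → Y) × ({j : Fin (2 ^ n) // j < i} → ZMod 2)) :
    0 ≤ W.bitDensity n i b z :=
  mul_nonneg (by positivity)
    (Finset.sum_nonneg fun _ _ => Finset.prod_nonneg fun _ _ => W.density_nonneg _ _)

theorem card_inputs (N : ℕ) (i : Fin N) (b : ZMod 2) :
    (Finset.univ.filter fun u : Fin N → ZMod 2 => u i = b).card = 2 ^ (N - 1) := by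
  have h : (Finset.univ.filter fun u : Fin N → ZMod 2 => u i = b) =
      Fintype.piFinset (fun j => if j = i then {b} else Finset.univ) := by
    ext u
    simp only [Finset.mem_filter, Finset.mem_univ, true_and, Fintype.mem_piFinset]
    constructor
    · intro hu j
      by_cases hj : j = i
      · subst hj; simp [hu]
      · simp [hj]
    · intro hu
      simpa using hu i
  rw [h, Fintype.card_piFinset, ← Finset.mul_prod_erase _ _ (Finset.mem_univ i),
    Finset.prod_congr rfl (g := fun _ => 2)]
  · simp
  · intro j hj
    rw [if_neg (Finset.ne_of_mem_erase hj)]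
    simp [ZMod.card]

theorem integral_bitDensity (W : BinaryChannel Y) (n : ℕ) (i : Fin (2 ^ n)) (b : ZMod 2) :
    ∫ z, W.bitDensity n i b z ∂((Measure.pi fun _ => W.ref).prod Measure.count) = 1 := by
  have hs := W.sigmaFinite_ref
  have hint : ∀ p, Integrable (fun y => W.bitDensity n i b (y, p)) (Measure.pi fun _ => W.ref) := by
    intro p
    simp only [bitDensity]
    refine Integrable.const_mul ?_ _
    refine integrable_finsetSum _ fun u _ => ?_
    exact W.integrable_prod_density n (encode n u)
  have hI : Integrable (W.bitDensity n i b) ((Measure.pi fun _ => W.ref).prod Measure.count) := by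
    rw [integrable_prod_iff' (W.measurable_bitDensity n i b).aestronglyMeasurable]
    exact ⟨Filter.Eventually.of_forall hint, Integrable.of_finite⟩
  rw [integral_prod_symm _ hI, integral_countable Integrable.of_finite, tsum_fintype]
  have h1 : ∀ p : {j : Fin (2 ^ n) // j < i} → ZMod 2,
      ∫ y, W.bitDensity n i b (y, p) ∂(Measure.pi fun _ => W.ref) =
      ((2 : ℝ) ^ (2 ^ n - 1))⁻¹ * ∑ u : Fin (2 ^ n) → ZMod 2 with u i = b,
        if (fun j : {j : Fin (2 ^ n) // j < i} => u j) = p then (1 : ℝ) else 0 := by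
    intro p
    simp only [bitDensity]
    rw [integral_const_mul, integral_finsetSum _ fun u _ =>
      W.integrable_prod_density n (encode n u)]
    simp only [integral_prod_density]
    rw [← Finset.sum_filter, Finset.filter_filter]
  simp only [h1, measureReal_def, Measure.count_singleton, ENNReal.toReal_one, one_smul]
  rw [← Finset.mul_sum, Finset.sum_comm]
  simp [card_inputs]

/-- The `i`-th bit-channel `W_N^{(i)}`, `N = 2 ^ n`: its input is `u_i`, its output is the
received word together with `u_0, …, u_{i-1}`, the other inputs being uniform. -/
def bitChannel (W : BinaryChannel Y) (n : ℕ) (i : Fin (2 ^ n)) :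
    BinaryChannel ((Fin (2 ^ n) → Y) × ({j : Fin (2 ^ n) // j < i} → ZMod 2)) where
  ref := (Measure.pi fun _ => W.ref).prod Measure.count
  sigmaFinite_ref := by
    have := W.sigmaFinite_ref
    infer_instance
  density := W.bitDensity n i
  measurable_density := W.measurable_bitDensity n i
  density_nonneg := W.bitDensity_nonneg n i
  integral_density := W.integral_bitDensity n i

/-- `A` is an information set of a polar code of length `2 ^ n` for the channel `W`: it consists
of `#A` bit-channels with the smallest Bhattacharyya parameters (ties broken arbitrarily). -/
def IsInformationSet (W : BinaryChannel Y) (n : ℕ) (A : Finset (Fin (2 ^ n))) : Prop :=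
  ∀ i ∈ A, ∀ j ∉ A, (W.bitChannel n i).bhattacharyya ≤ (W.bitChannel n j).bhattacharyya

end BinaryChannel

/-! ### The factor graph and its stopping sets -/

/-- Variable nodes `v(r, c)`: rows `0 ≤ r < 2 ^ n`, columns (stages) `0 ≤ c ≤ n`. -/
abbrev VarNode (n : ℕ) := Fin (2 ^ n) × Fin (n + 1)

/-- Check nodes `c(r, c)`: rows `0 ≤ r < 2 ^ n`, between the columns `c` and `c + 1`. -/
abbrev CheckNode (n : ℕ) := Fin (2 ^ n) × Fin n

/-- Adjacency in the factor graph. With `p = n - 1 - c`, the check node `c(r, c)` is adjacent to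
`v(r, c)`, to `v(r, c + 1)`, and, if bit `p` of `r` is `0`, also to `v(r + 2 ^ p, c)`. -/
def Adj {n : ℕ} (v : VarNode n) (k : CheckNode n) : Prop :=
  v = (k.1, k.2.castSucc) ∨ v = (k.1, k.2.succ) ∨
    ((k.1 : ℕ).testBit (n - 1 - k.2) = false ∧
      v.2 = k.2.castSucc ∧ (v.1 : ℕ) = k.1 + 2 ^ (n - 1 - (k.2 : ℕ)))

open Classical in
/-- A stopping set: a non-empty set of variable nodes such that every check node adjacent to it
is adjacent to at least two of its members. -/
def IsStoppingSet {n : ℕ} (S : Finset (VarNode n)) : Prop :=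
  S.Nonempty ∧ ∀ k : CheckNode n, (∃ v ∈ S, Adj v k) → 2 ≤ (S.filter fun v => Adj v k).card

/-- The information nodes of a set of variable nodes: its members on the leftmost stage. -/
def infoNodes {n : ℕ} (S : Finset (VarNode n)) : Finset (Fin (2 ^ n)) :=
  Finset.univ.filter fun r => (r, 0) ∈ S

/-- The observed nodes of a set of variable nodes: its members on the rightmost stage. -/
def observedNodes {n : ℕ} (S : Finset (VarNode n)) : Finset (Fin (2 ^ n)) :=
  Finset.univ.filter fun r => (r, Fin.last n) ∈ S

/-- `V` is a variable-node stopping set for `J`, a `VSS(J)`: the set of observed nodes of a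
stopping set whose information nodes are precisely `J`. -/
def IsVSS {n : ℕ} (J V : Finset (Fin (2 ^ n))) : Prop :=
  ∃ S : Finset (VarNode n), IsStoppingSet S ∧ infoNodes S = J ∧ observedNodes S = V

/-- `V` is a minimum variable-node stopping set for `J`, an `MVSS(J)`. -/
def IsMVSS {n : ℕ} (J V : Finset (Fin (2 ^ n))) : Prop :=
  IsVSS J V ∧ ∀ V', IsVSS J V' → V.card ≤ V'.card

/-- `S` is a stopping tree of `i`: a stopping set whose only information node is `i`. -/
def IsStoppingTree {n : ℕ} (i : Fin (2 ^ n)) (S : Finset (VarNode n)) : Prop :=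
  IsStoppingSet S ∧ infoNodes S = {i}

theorem testBit_add_two_pow {r p : ℕ} (h : r.testBit p = false) (k : ℕ) :
    (r + 2 ^ p).testBit k = (decide (k = p) || r.testBit k) := by
  rw [add_comm]
  rcases lt_trichotomy k p with hk | hk | hk
  · rw [Nat.testBit_two_pow_add_gt hk]; simp [hk.ne]
  · subst hk; rw [Nat.testBit_two_pow_add_eq]; simp [h]
  · have hq : (2 ^ p + r) / 2 ^ (p + 1) = r / 2 ^ (p + 1) := by
      have hp : 0 < 2 ^ p := by positivity
      rw [pow_succ, ← Nat.div_div_eq_div_mul, ← Nat.div_div_eq_div_mul, Nat.add_div_left _ hp]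
      have : (r / 2 ^ p) % 2 = 0 := by
        rw [Nat.testBit_eq_decide_div_mod_eq] at h
        have := of_decide_eq_false h
        omega
      omega
    obtain ⟨d, rfl⟩ := Nat.exists_eq_add_of_lt hk
    have e : p + d + 1 = d + (p + 1) := by ring
    rw [e, ← Nat.testBit_div_two_pow, hq, Nat.testBit_div_two_pow]
    simp; omega

/-- Row `r` at column `c` belongs to the stopping tree of `i`. -/
def TreeRel (n : ℕ) (i r c : ℕ) : Prop :=
  ∀ k < n, (k + c < n → r.testBit k = i.testBit k) ∧
    (n ≤ k + c → r.testBit k = true → i.testBit k = true)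

theorem treeRel_zero {n : ℕ} (i r : Fin (2 ^ n)) : TreeRel n i r 0 ↔ r = i := by
  constructor
  · intro h
    refine Fin.ext (Nat.eq_of_testBit_eq fun k => ?_)
    by_cases hk : k < n
    · exact (h k hk).1 (by omega)
    · have : 2 ^ n ≤ 2 ^ k := Nat.pow_le_pow_right (by norm_num) (by omega)
      rw [Nat.testBit_lt_two_pow (by omega), Nat.testBit_lt_two_pow (by omega)]
  · rintro rfl k hk
    exact ⟨fun _ => rfl, fun h => by omega⟩

theorem treeRel_left {n i r c : ℕ} (hc : c < n) :
    TreeRel n i r c ↔ TreeRel n i r (c + 1) ∧ r.testBit (n - 1 - c) = i.testBit (n - 1 - c) := by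
  constructor
  · intro h
    refine ⟨fun k hk => ⟨fun h' => (h k hk).1 (by omega), fun h' hr => ?_⟩,
      (h _ (by omega)).1 (by omega)⟩
    by_cases hkc : n ≤ k + c
    · exact (h k hk).2 hkc hr
    · rw [← (h k hk).1 (by omega)]; exact hr
  · rintro ⟨h, hp⟩ k hk
    refine ⟨fun h' => ?_, fun h' => (h k hk).2 (by omega)⟩
    by_cases hkc : k = n - 1 - c
    · rw [hkc]; exact hp
    · exact (h k hk).1 (by omega)

theorem treeRel_shift {n i r c : ℕ} (hc : c < n) (hr : r.testBit (n - 1 - c) = false) :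
    TreeRel n i (r + 2 ^ (n - 1 - c)) c ↔
      TreeRel n i r (c + 1) ∧ i.testBit (n - 1 - c) = true := by
  constructor
  · intro h
    have hp : i.testBit (n - 1 - c) = true := by
      rw [← (h _ (by omega)).1 (by omega), testBit_add_two_pow hr]; simp
    refine ⟨fun k hk => ?_, hp⟩
    have hk' := h k hk
    rw [testBit_add_two_pow hr] at hk'
    refine ⟨fun h' => ?_, fun h' hrk => ?_⟩
    · have := hk'.1 (by omega)
      simpa [show k ≠ n - 1 - c by omega] using this
    · by_cases hkc : n ≤ k + c
      · exact hk'.2 hkc (by simp [hrk])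
      · rw [show k = n - 1 - c by omega]; exact hp
  · rintro ⟨h, hp⟩ k hk
    rw [testBit_add_two_pow hr]
    by_cases hkc : k = n - 1 - c
    · subst hkc; simp [hp]
    · simp only [hkc, decide_false, Bool.false_or]
      exact ⟨fun h' => (h k hk).1 (by omega), fun h' => (h k hk).2 (by omega)⟩

theorem shift_lt {n r c : ℕ} (hc : c < n) (hrn : r < 2 ^ n)
    (hr : r.testBit (n - 1 - c) = false) : r + 2 ^ (n - 1 - c) < 2 ^ n := by
  refine Nat.lt_pow_two_of_testBit _ fun k hk => ?_
  have : 2 ^ n ≤ 2 ^ k := Nat.pow_le_pow_right (by norm_num) hk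
  rw [testBit_add_two_pow hr, Nat.testBit_lt_two_pow (x := r) (i := k) (by omega)]
  simp; omega

open Classical in
/-- The explicit stopping tree of `i`. -/
def treeSet {n : ℕ} (i : Fin (2 ^ n)) : Finset (VarNode n) :=
  Finset.univ.filter fun v => TreeRel n i v.1 v.2

theorem mem_treeSet {n : ℕ} (i : Fin (2 ^ n)) (v : VarNode n) :
    v ∈ treeSet i ↔ TreeRel n i v.1 v.2 := by simp [treeSet]

theorem isStoppingTree_treeSet {n : ℕ} (i : Fin (2 ^ n)) : IsStoppingTree i (treeSet i) := by
  classical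
  refine ⟨⟨⟨(i, 0), ?_⟩, ?_⟩, ?_⟩
  · rw [mem_treeSet]; exact (treeRel_zero i i).2 rfl
  · rintro ⟨r, c⟩ ⟨v, hv, hadj⟩
    have hc := c.2
    have hQ : TreeRel n i r (c + 1) := by
      rw [mem_treeSet] at hv
      rcases hadj with rfl | rfl | ⟨hb, h2, h1⟩
      · exact ((treeRel_left hc).1 hv).1
      · exact hv
      · rw [h1, h2] at hv
        exact ((treeRel_shift hc hb).1 hv).1
    have hb : ((r, c.succ) : VarNode n) ∈ (treeSet i).filter fun v => Adj v (r, c) := by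
      rw [Finset.mem_filter, mem_treeSet]
      exact ⟨by simpa using hQ, Or.inr (Or.inl rfl)⟩
    suffices h : ∃ r' : Fin (2 ^ n), ((r', c.castSucc) : VarNode n) ∈
        (treeSet i).filter fun v => Adj v (r, c) by
      obtain ⟨r', hr'⟩ := h
      refine Finset.one_lt_card.2 ⟨_, hr', _, hb, fun he => ?_⟩
      have := congrArg (fun v : VarNode n => (v.2 : ℕ)) he
      simp at this
    by_cases hp : (r : ℕ).testBit (n - 1 - c) = (i : ℕ).testBit (n - 1 - c)
    · refine ⟨r, ?_⟩
      rw [Finset.mem_filter, mem_treeSet]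
      exact ⟨(treeRel_left hc).2 ⟨hQ, hp⟩, Or.inl rfl⟩
    · have hrp : (r : ℕ).testBit (n - 1 - c) = false := by
        have := (hQ (n - 1 - c) (by omega)).2 (by omega)
        by_contra hr
        rw [Bool.not_eq_false] at hr
        exact hp (by rw [hr, this hr])
      have hip : (i : ℕ).testBit (n - 1 - c) = true := by
        rw [hrp] at hp
        simpa using Ne.symm hp
      refine ⟨⟨r + 2 ^ (n - 1 - (c : ℕ)), shift_lt hc r.2 hrp⟩, ?_⟩
      rw [Finset.mem_filter, mem_treeSet]
      exact ⟨(treeRel_shift hc hrp).2 ⟨hQ, hip⟩, Or.inr (Or.inr ⟨hrp, rfl, rfl⟩)⟩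
  · ext r
    simp only [infoNodes, Finset.mem_filter, Finset.mem_univ, true_and, mem_treeSet,
      Finset.mem_singleton]
    exact treeRel_zero i r

theorem eq_treeSet {n : ℕ} {i : Fin (2 ^ n)} {S : Finset (VarNode n)} (hS : IsStoppingTree i S) :
    S = treeSet i := by
  classical
  obtain ⟨⟨-, hS⟩, hi⟩ := hS
  have key : ∀ c : ℕ, ∀ hc : c < n + 1, ∀ r : Fin (2 ^ n),
      ((r, ⟨c, hc⟩) : VarNode n) ∈ S ↔ TreeRel n i r c := by
    intro c
    induction c with
    | zero =>
      intro hc r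
      rw [treeRel_zero]
      have : r ∈ infoNodes S ↔ r = i := by rw [hi, Finset.mem_singleton]
      simpa [infoNodes] using this
    | succ c ih =>
      intro hc r
      have hcn : c < n := by omega
      -- a check node next to `S` has two neighbours in `S`
      have hk := hS (r, ⟨c, hcn⟩)
      constructor
      · intro hr
        have h2 := hk ⟨_, hr, Or.inr (Or.inl rfl)⟩
        obtain ⟨v, hv, hne⟩ := Finset.exists_mem_ne h2 (r, ⟨c + 1, hc⟩)
        rw [Finset.mem_filter] at hv
        rcases hv with ⟨hv, rfl | rfl | ⟨hb, e2, e1⟩⟩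
        · exact ((treeRel_left hcn).1 ((ih (by omega) r).1 hv)).1
        · exact absurd rfl hne
        · obtain ⟨v1, v2⟩ := v
          simp only at e1 e2
          subst e2
          have := (ih (by omega) v1).1 hv
          rw [e1] at this
          exact ((treeRel_shift hcn hb).1 this).1
      · intro hQ
        by_contra hr
        have hmem : ∀ v ∈ S.filter (fun v => Adj v (r, (⟨c, hcn⟩ : Fin n))),
            (v = (r, ⟨c, by omega⟩) ∧ (r : ℕ).testBit (n - 1 - c) = (i : ℕ).testBit (n - 1 - c)) ∨
            ((r : ℕ).testBit (n - 1 - c) = false ∧ (i : ℕ).testBit (n - 1 - c) = true ∧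
              v.2 = ⟨c, by omega⟩ ∧ (v.1 : ℕ) = r + 2 ^ (n - 1 - c)) := by
          intro v hv
          rw [Finset.mem_filter] at hv
          rcases hv with ⟨hv, rfl | rfl | ⟨hb, e2, e1⟩⟩
          · exact Or.inl ⟨rfl, ((treeRel_left hcn).1 ((ih (by omega) r).1 hv)).2⟩
          · exact absurd hv hr
          · obtain ⟨v1, v2⟩ := v
            simp only at e1 e2
            subst e2
            have := (ih (by omega) v1).1 hv
            rw [e1] at this
            exact Or.inr ⟨hb, ((treeRel_shift hcn hb).1 this).2, rfl, e1⟩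
        have hex : ∃ v ∈ S, Adj v (r, (⟨c, hcn⟩ : Fin n)) := by
          by_cases hp : (r : ℕ).testBit (n - 1 - c) = (i : ℕ).testBit (n - 1 - c)
          · exact ⟨(r, ⟨c, by omega⟩), (ih (by omega) r).2 ((treeRel_left hcn).2 ⟨hQ, hp⟩),
              Or.inl rfl⟩
          · have hrp : (r : ℕ).testBit (n - 1 - c) = false := by
              have := (hQ (n - 1 - c) (by omega)).2 (by omega)
              by_contra hr
              rw [Bool.not_eq_false] at hr
              exact hp (by rw [hr, this hr])
            have hip : (i : ℕ).testBit (n - 1 - c) = true := by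
              rw [hrp] at hp
              simpa using Ne.symm hp
            exact ⟨(⟨r + 2 ^ (n - 1 - c), shift_lt hcn r.2 hrp⟩, ⟨c, by omega⟩),
              (ih (by omega) _).2 ((treeRel_shift hcn hrp).2 ⟨hQ, hip⟩),
              Or.inr (Or.inr ⟨hrp, rfl, rfl⟩)⟩
        obtain ⟨v, hv, w, hw, hne⟩ := Finset.one_lt_card.1 (hk hex)
        rcases hmem v hv with ⟨rfl, h1⟩ | ⟨h1, h2, h3, h4⟩ <;>
          rcases hmem w hw with ⟨rfl, g1⟩ | ⟨g1, g2, g3, g4⟩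
        · exact hne rfl
        · rw [g1, g2] at h1; cases h1
        · rw [h1, h2] at g1; cases g1
        · exact hne (Prod.ext (Fin.ext (h4.trans g4.symm)) (h3.trans g3.symm))
  ext v
  rw [mem_treeSet]
  exact key v.2 v.2.2 v.1

/-- Every index has exactly one stopping tree. -/
theorem existsUnique_stoppingTree {n : ℕ} (i : Fin (2 ^ n)) :
    ∃! S : Finset (VarNode n), IsStoppingTree i S :=
  ⟨treeSet i, isStoppingTree_treeSet i, fun _ hS => eq_treeSet hS⟩

/-- The stopping tree `ST(i)`. -/
def stoppingTree {n : ℕ} (i : Fin (2 ^ n)) : Finset (VarNode n) :=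
  (existsUnique_stoppingTree i).choose

/-- `f(i)`, the number of leaves (nodes on the rightmost stage) of the stopping tree `ST(i)`. -/
def leafCount {n : ℕ} (i : Fin (2 ^ n)) : ℕ :=
  (observedNodes (stoppingTree i)).card

end Polar

end

/-!
The proof has a combinatorial and a probabilistic half, linked by the notion `Polar.MoveClosed`.

Combinatorial half. One has `f(i) = 2 ^ wt(i)`, where `wt` counts binary ones
(`Polar.leafCount_eq`). Between columns `c` and `c + 1` a stopping set treats the digit `p = n-1-c`
as follows: rows with digit `1` keep their status, and for a row `r` with digit `0` the number of
members among `v(r, c)`, `v(r + 2 ^ p, c)`, `v(r, c + 1)` is not `1`. Cutting the rows into blocks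
and running the columns backwards gives `|V| ≥ min_{i ∈ J} f(i)` for every `VSS(J)`, for any non-empty
`J` (`Polar.IsVSS.exists_leafCount_le`). Equality for `A` holds when `A` is closed under turning a
digit `0` into `1` and under moving a digit `1` one place up into a `0`: if `k` is the least weight
in `A`, then `A` contains every row whose `k` leading digits are `1`, and a stopping set with `2 ^ k`
observed nodes can be written down (`Polar.MoveClosed.exists_isVSS`).

Probabilistic half. An information set is closed under these moves because each of them strictly
decreases the Bhattacharyya parameter, so that ties play no role. The leading digit of `i` selects
the first transform applied to the channel (`bhattacharyya_bitChannel_minus` and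
`bhattacharyya_bitChannel_plus`), hence it suffices to compare `W⁻` with `W⁺` and `W⁻⁺` with `W⁺⁻`,
and to carry a comparison through further transforms. Channels are compared by the integrals of all
symmetric, homogeneous, superadditive functions of the two likelihoods (`Polar.SymmConcave`). This
order passes through both transforms because, with one factor fixed, they turn such a function into
another one. Strictness is tracked by the harmonic function `ab / (a + b)`: as long as the channel is
neither noiseless nor completely noisy, a positive multiple of it can be split off after either
transform, and also off `√(ab)`. The comparison of `W⁻⁺` with `W⁺⁻` is pointwise: the former is
obtained from the latter by merging pairs of outputs.
-/

noncomputable section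

namespace Polar

/-! ### Combinatorics of stopping sets -/

theorem isStoppingSet_iff {n : ℕ} {S : Finset (VarNode n)} :
    IsStoppingSet S ↔ S.Nonempty ∧
      ∀ (k : CheckNode n), ∀ v ∈ S, Adj v k → ∃ w ∈ S, w ≠ v ∧ Adj w k := by
  classical
  refine and_congr_right fun _ => forall_congr' fun k => ⟨fun h v hv hk => ?_, ?_⟩
  · obtain ⟨w, hw, hne⟩ := Finset.exists_mem_ne (h ⟨v, hv, hk⟩) v
    rw [Finset.mem_filter] at hw
    exact ⟨w, hw.1, hne, hw.2⟩
  · rintro h ⟨v, hv, hk⟩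
    obtain ⟨w, hw, hne, hwk⟩ := h v hv hk
    exact Finset.one_lt_card.2
      ⟨v, Finset.mem_filter.2 ⟨hv, hk⟩, w, Finset.mem_filter.2 ⟨hw, hwk⟩, hne.symm⟩

/-- The number of ones among the `m` lowest binary digits of `r`. -/
def weight (m r : ℕ) : ℕ := ((Finset.range m).filter fun k => r.testBit k = true).card

theorem weight_succ (m r : ℕ) :
    weight (m + 1) r = weight m r + if r.testBit m = true then 1 else 0 := by
  simp only [weight, Finset.card_filter, Finset.sum_range_succ]

theorem weight_congr {m r s : ℕ} (h : ∀ k < m, r.testBit k = s.testBit k) :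
    weight m r = weight m s := by
  unfold weight
  congr 1
  exact Finset.filter_congr fun k hk => by rw [h k (Finset.mem_range.1 hk)]

theorem weight_add_two_pow (m r : ℕ) (hr : r.testBit m = false) :
    weight m (r + 2 ^ m) = weight m r :=
  weight_congr fun k hk => by rw [testBit_add_two_pow hr]; simp [hk.ne]

theorem card_submasks (m i : ℕ) :
    ((Finset.range (2 ^ m)).filter
      fun r => ∀ k < m, r.testBit k = true → i.testBit k = true).card = 2 ^ weight m i := by
  induction m with
  | zero => simp [weight]
  | succ m ih =>
    have hlow : ∀ r < 2 ^ m, r.testBit m = false := fun r hr => Nat.testBit_lt_two_pow hr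
    rw [Finset.card_filter] at ih ⊢
    rw [pow_succ, mul_two, Finset.sum_range_add, weight_succ, pow_add]
    have h1 : ∀ r ∈ Finset.range (2 ^ m),
        (if ∀ k < m + 1, r.testBit k = true → i.testBit k = true then 1 else 0) =
        if ∀ k < m, r.testBit k = true → i.testBit k = true then 1 else 0 := by
      intro r hr
      have := hlow r (Finset.mem_range.1 hr)
      congr 1
      simp only [Nat.forall_lt_succ_right, this, eq_iff_iff]
      simp
    have h2 : ∀ r ∈ Finset.range (2 ^ m),
        (if ∀ k < m + 1, (2 ^ m + r).testBit k = true → i.testBit k = true then 1 else 0) =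
        (if ∀ k < m, r.testBit k = true → i.testBit k = true then 1 else 0) *
          if i.testBit m = true then 1 else 0 := by
      intro r hr
      have hr := hlow r (Finset.mem_range.1 hr)
      rw [mul_ite, mul_one, mul_zero, ← ite_and]
      congr 1
      rw [Nat.forall_lt_succ_right, add_comm, eq_iff_iff]
      rw [and_comm (a := i.testBit m = true)]
      refine and_congr (forall₂_congr fun k hk => ?_) ?_
      · rw [testBit_add_two_pow hr]; simp [hk.ne]
      · rw [testBit_add_two_pow hr]; simp
    rw [Finset.sum_congr rfl h1, Finset.sum_congr rfl h2, ← Finset.sum_mul, ih]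
    split_ifs <;> simp; ring

theorem leafCount_eq {n : ℕ} (i : Fin (2 ^ n)) : leafCount i = 2 ^ weight n i := by
  have h : stoppingTree i = treeSet i := eq_treeSet (existsUnique_stoppingTree i).choose_spec.1
  rw [leafCount, h, ← card_submasks, ← Finset.card_map Fin.valEmbedding]
  congr 1
  ext r
  simp only [observedNodes, mem_treeSet, Finset.mem_map, Finset.mem_filter, Finset.mem_univ,
    true_and, Finset.mem_range, TreeRel, Fin.val_last]
  constructor
  · rintro ⟨r, h, rfl⟩
    exact ⟨r.2, fun k hk => (h k hk).2 (by omega)⟩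
  · rintro ⟨hr, h⟩
    exact ⟨⟨r, hr⟩, fun k hk => ⟨fun h' => by omega, fun _ => h k hk⟩, rfl⟩

/-- The check nodes force three relations between consecutive columns of a stopping set, according
to the digit that separates the two columns. -/
theorem IsStoppingSet.column {n : ℕ} {S : Finset (VarNode n)} (hS : IsStoppingSet S) {c : ℕ}
    (hc : c < n) (r : Fin (2 ^ n)) :
    ((r : ℕ).testBit (n - 1 - c) = true →
      ((r, ⟨c, by omega⟩) ∈ S ↔ (r, ⟨c + 1, by omega⟩) ∈ S)) ∧
    ∀ r' : Fin (2 ^ n), (r : ℕ).testBit (n - 1 - c) = false → (r' : ℕ) = r + 2 ^ (n - 1 - c) →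
      ((r, ⟨c, by omega⟩) ∈ S → (r', ⟨c, by omega⟩) ∈ S ∨ (r, ⟨c + 1, by omega⟩) ∈ S) ∧
      ((r', ⟨c, by omega⟩) ∈ S → (r, ⟨c, by omega⟩) ∈ S ∨ (r, ⟨c + 1, by omega⟩) ∈ S) ∧
      ((r, ⟨c + 1, by omega⟩) ∈ S → (r, ⟨c, by omega⟩) ∈ S ∨ (r', ⟨c, by omega⟩) ∈ S) := by
  have h := (isStoppingSet_iff.1 hS).2 (r, ⟨c, hc⟩)
  refine ⟨fun hb => ⟨fun hv => ?_, fun hv => ?_⟩, fun r' hb hr' => ⟨fun hv => ?_, fun hv => ?_,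
    fun hv => ?_⟩⟩
  · obtain ⟨w, hw, hne, rfl | rfl | ⟨h1, -⟩⟩ := h _ hv (Or.inl rfl)
    · exact absurd rfl hne
    · exact hw
    · simp only at h1; rw [hb] at h1; cases h1
  · obtain ⟨w, hw, hne, rfl | rfl | ⟨h1, -⟩⟩ := h _ hv (Or.inr (Or.inl rfl))
    · exact hw
    · exact absurd rfl hne
    · simp only at h1; rw [hb] at h1; cases h1
  all_goals
    have key : ∀ w : VarNode n, w.2 = (⟨c, hc⟩ : Fin n).castSucc → (w.1 : ℕ) = r + 2 ^ (n - 1 - c) →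
        w = (r', ⟨c, by omega⟩) := fun w h2 h3 => Prod.ext (Fin.ext (h3.trans hr'.symm)) h2
  · obtain ⟨w, hw, hne, rfl | rfl | ⟨-, h2, h3⟩⟩ := h _ hv (Or.inl rfl)
    · exact absurd rfl hne
    · exact Or.inr hw
    · rw [key w h2 h3] at hw; exact Or.inl hw
  · obtain ⟨w, hw, hne, rfl | rfl | ⟨-, h2, h3⟩⟩ := h _ hv (Or.inr (Or.inr ⟨hb, rfl, hr'⟩))
    · exact Or.inl hw
    · exact Or.inr hw
    · exact absurd (key w h2 h3) hne
  · obtain ⟨w, hw, hne, rfl | rfl | ⟨-, h2, h3⟩⟩ := h _ hv (Or.inr (Or.inl rfl))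
    · exact Or.inl hw
    · exact absurd rfl hne
    · rw [key w h2 h3] at hw; exact Or.inr hw

theorem div_two_pow_eq_iff (r m t : ℕ) : r / 2 ^ (m + 1) = t ↔
    (r / 2 ^ m = 2 * t ∧ r.testBit m = false) ∨ (r / 2 ^ m = 2 * t + 1 ∧ r.testBit m = true) := by
  rw [pow_succ, ← Nat.div_div_eq_div_mul, Nat.testBit_eq_decide_div_mod_eq]
  simp only [decide_eq_false_iff_not, decide_eq_true_eq]
  omega

/-- Cut the rows into blocks of length `2 ^ m` at column `n - m`. A stopping set that meets a block
has, in the last column of that block, at least `2 ^ weight m r` members, for some row `r` of the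
block in which it meets column `n - m`. -/
theorem IsStoppingSet.exists_two_pow_weight_le {n : ℕ} {S : Finset (VarNode n)}
    (hS : IsStoppingSet S) (m : ℕ) : ∀ (c : ℕ) (hc : c < n + 1), m + c = n → ∀ t : ℕ,
      (∃ r : Fin (2 ^ n), (r, ⟨c, hc⟩) ∈ S ∧ (r : ℕ) / 2 ^ m = t) →
      ∃ r : Fin (2 ^ n), (r, ⟨c, hc⟩) ∈ S ∧ (r : ℕ) / 2 ^ m = t ∧
        2 ^ weight m r ≤ ((observedNodes S).filter fun r : Fin (2 ^ n) => (r : ℕ) / 2 ^ m = t).card := by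
  induction m with
  | zero =>
    rintro c hc rfl' t ⟨r, hr, hrt⟩
    refine ⟨r, hr, hrt, ?_⟩
    have hc' : (⟨c, hc⟩ : Fin (n + 1)) = Fin.last n := Fin.ext (by simpa using rfl')
    rw [hc'] at hr
    simp only [weight, Finset.range_zero, Finset.filter_empty, Finset.card_empty, pow_zero]
    exact Finset.card_pos.2 ⟨r, Finset.mem_filter.2 ⟨by simp [observedNodes, hr], hrt⟩⟩
  | succ m ih =>
    intro c hc hmc t hex
    have hcn : c < n := by omega
    have hp : n - 1 - c = m := by omega
    have hcol := fun r => hS.column hcn r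
    rw [hp] at hcol
    have ih := ih (c + 1) (by omega) (by omega)
    -- the block splits into two halves, according to digit `m`
    have hcard : ((observedNodes S).filter fun r : Fin (2 ^ n) => (r : ℕ) / 2 ^ (m + 1) = t).card =
        ((observedNodes S).filter fun r : Fin (2 ^ n) => (r : ℕ) / 2 ^ m = 2 * t).card +
        ((observedNodes S).filter fun r : Fin (2 ^ n) => (r : ℕ) / 2 ^ m = 2 * t + 1).card := by
      rw [← Finset.card_union_of_disjoint, ← Finset.filter_or]
      · congr 1
        refine Finset.filter_congr fun r _ => ?_
        rw [pow_succ, ← Nat.div_div_eq_div_mul]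
        omega
      · exact Finset.disjoint_filter.2 fun r _ h1 h2 => by omega
    have hbit0 : ∀ r : ℕ, r / 2 ^ m = 2 * t → r.testBit m = false := by
      intro r hr
      rw [Nat.testBit_eq_decide_div_mod_eq, hr]; simp
    have hbit1 : ∀ r : ℕ, r / 2 ^ m = 2 * t + 1 → r.testBit m = true := by
      intro r hr
      rw [Nat.testBit_eq_decide_div_mod_eq, hr]; simp
    have hup : ∀ r : ℕ, (r + 2 ^ m) / 2 ^ m = r / 2 ^ m + 1 := fun r =>
      Nat.add_div_right _ (by positivity)
    have hw0 : ∀ r : ℕ, r / 2 ^ m = 2 * t → weight (m + 1) r = weight m r := by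
      intro r hr; rw [weight_succ, hbit0 r hr]; simp
    have hw1 : ∀ r : ℕ, r / 2 ^ m = 2 * t + 1 → weight (m + 1) r = weight m r + 1 := by
      intro r hr; rw [weight_succ, hbit1 r hr]; simp
    have hd0 : ∀ r : ℕ, r / 2 ^ m = 2 * t → r / 2 ^ (m + 1) = t := fun r hr =>
      (div_two_pow_eq_iff _ _ _).2 (Or.inl ⟨hr, hbit0 r hr⟩)
    have hd1 : ∀ r : ℕ, r / 2 ^ m = 2 * t + 1 → r / 2 ^ (m + 1) = t := fun r hr =>
      (div_two_pow_eq_iff _ _ _).2 (Or.inr ⟨hr, hbit1 r hr⟩)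
    have hshift : ∀ r : Fin (2 ^ n), (r : ℕ) / 2 ^ m = 2 * t → (r : ℕ) + 2 ^ m < 2 ^ n := by
      intro r hr
      have := shift_lt hcn r.2 (by rw [hp]; exact hbit0 r hr)
      rwa [hp] at this
    rw [hcard]
    by_cases h1 : ∃ r : Fin (2 ^ n), (r, (⟨c, hc⟩ : Fin (n + 1))) ∈ S ∧ (r : ℕ) / 2 ^ m = 2 * t + 1
    · obtain ⟨r1, hr1, hr1t⟩ := h1
      obtain ⟨r1, hr1, hr1t, hle1⟩ := ih (2 * t + 1)
        ⟨r1, ((hcol r1).1 (hbit1 r1 hr1t)).1 hr1, hr1t⟩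
      have hr1c := ((hcol r1).1 (hbit1 r1 hr1t)).2 hr1
      by_cases h0 : ∃ r : Fin (2 ^ n), (r, (⟨c + 1, by omega⟩ : Fin (n + 1))) ∈ S ∧
          (r : ℕ) / 2 ^ m = 2 * t
      · obtain ⟨r0, hr0, hr0t, hle0⟩ := ih (2 * t) h0
        rcases ((hcol r0).2 ⟨r0 + 2 ^ m, hshift r0 hr0t⟩ (hbit0 r0 hr0t) rfl).2.2 hr0 with h | h
        · exact ⟨r0, h, hd0 _ hr0t, by rw [hw0 _ hr0t]; omega⟩
        · rcases le_total (weight m r0) (weight m r1) with hle | hle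
          · have ht1 : ((r0 : ℕ) + 2 ^ m) / 2 ^ m = 2 * t + 1 := by rw [hup, hr0t]
            refine ⟨_, h, hd1 _ ht1, ?_⟩
            have := Nat.pow_le_pow_right (n := 2) (by norm_num) hle
            rw [hw1 _ ht1, weight_add_two_pow _ _ (hbit0 _ hr0t), pow_succ]
            omega
          · refine ⟨r1, hr1c, hd1 _ hr1t, ?_⟩
            have := Nat.pow_le_pow_right (n := 2) (by norm_num) hle
            rw [hw1 _ hr1t, pow_succ]
            omega
      · -- the lower half is empty at column `c + 1`, so both halves agree at column `c`
        have hge : 2 ^ m ≤ (r1 : ℕ) := by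
          by_contra hlt
          rw [Nat.div_eq_of_lt (by omega)] at hr1t
          omega
        have hr1' : (r1 : ℕ) = (r1 - 2 ^ m) + 2 ^ m := by omega
        have ht0 : ((r1 : ℕ) - 2 ^ m) / 2 ^ m = 2 * t := by
          have := hup (r1 - 2 ^ m)
          rw [← hr1', hr1t] at this
          omega
        rcases ((hcol ⟨r1 - 2 ^ m, (Nat.sub_le _ _).trans_lt r1.2⟩).2 r1 (hbit0 _ ht0) hr1').2.1 hr1c with h | h
        · refine ⟨_, h, hd0 _ ht0, ?_⟩
          have := weight_add_two_pow m _ (hbit0 _ ht0)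
          rw [← hr1'] at this
          rw [hw0 _ ht0]
          simp only [← this]
          omega
        · exact absurd ⟨_, h, ht0⟩ h0
    · obtain ⟨r, hr, hrt⟩ := hex
      rcases (div_two_pow_eq_iff _ _ _).1 hrt with ⟨hrt, hb⟩ | ⟨hrt, hb⟩
      · have hno : ∀ (r : Fin (2 ^ n)) (h : (r : ℕ) / 2 ^ m = 2 * t),
            ((⟨r + 2 ^ m, hshift r h⟩ : Fin (2 ^ n)), (⟨c, hc⟩ : Fin (n + 1))) ∉ S :=
          fun r h hmem => h1 ⟨_, hmem, by simp only [hup, h]⟩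
        obtain ⟨r0, hr0, hr0t, hle0⟩ := ih (2 * t) ⟨r,
          (((hcol r).2 ⟨r + 2 ^ m, hshift r hrt⟩ hb rfl).1 hr).resolve_left (hno r hrt), hrt⟩
        have := (((hcol r0).2 ⟨r0 + 2 ^ m, hshift r0 hr0t⟩ (hbit0 r0 hr0t) rfl).2.2
          hr0).resolve_right (hno r0 hr0t)
        exact ⟨r0, this, hd0 _ hr0t, by rw [hw0 _ hr0t]; omega⟩
      · exact absurd ⟨r, hr, hrt⟩ h1

/-- Every `VSS(J)` has at least `min_{i ∈ J} f(i)` elements. -/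
theorem IsVSS.exists_leafCount_le {n : ℕ} {J V : Finset (Fin (2 ^ n))} (hJ : J.Nonempty)
    (h : IsVSS J V) : ∃ i ∈ J, leafCount i ≤ V.card := by
  obtain ⟨S, hS, rfl, rfl⟩ := h
  obtain ⟨r, hr⟩ := hJ
  have hzero : ∀ r : Fin (2 ^ n), (r : ℕ) / 2 ^ n = 0 := fun r => Nat.div_eq_of_lt r.2
  obtain ⟨i, hi, -, hle⟩ := hS.exists_two_pow_weight_le n 0 (by omega) (by omega) 0
    ⟨r, by simpa [infoNodes] using hr, hzero r⟩
  refine ⟨i, by simpa [infoNodes] using hi, ?_⟩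
  rw [leafCount_eq]
  exact hle.trans (Finset.card_le_card (Finset.filter_subset _ _))

/-- A family of column predicates satisfying the check node constraints gives a stopping set. -/
theorem isStoppingSet_of_column {n : ℕ} (P : ℕ → ℕ → Prop) (hne : ∃ r < 2 ^ n, P 0 r)
    (hone : ∀ c < n, ∀ r < 2 ^ n, r.testBit (n - 1 - c) = true → (P c r ↔ P (c + 1) r))
    (hzero : ∀ c < n, ∀ r < 2 ^ n, r.testBit (n - 1 - c) = false →
      (P c r → P c (r + 2 ^ (n - 1 - c)) ∨ P (c + 1) r) ∧
      (P c (r + 2 ^ (n - 1 - c)) → P c r ∨ P (c + 1) r) ∧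
      (P (c + 1) r → P c r ∨ P c (r + 2 ^ (n - 1 - c))))
    (S : Finset (VarNode n)) (hS : ∀ v : VarNode n, v ∈ S ↔ P v.2 v.1) : IsStoppingSet S := by
  obtain ⟨r, hr, hr0⟩ := hne
  refine isStoppingSet_iff.2 ⟨⟨(⟨r, hr⟩, 0), (hS _).2 hr0⟩, ?_⟩
  rintro ⟨r, c⟩ v hv hadj
  have hne1 : ∀ r r' : Fin (2 ^ n), ((r, c.succ) : VarNode n) ≠ (r', c.castSucc) := by
    intro r r' he
    have := congrArg (fun v : VarNode n => (v.2 : ℕ)) he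
    simp at this
  have hL : ((r, c.castSucc) : VarNode n) ∈ S ↔ P c r := hS _
  have hR : ((r, c.succ) : VarNode n) ∈ S ↔ P (c + 1) r := hS _
  cases hb : (r : ℕ).testBit (n - 1 - c) with
  | true =>
    rcases hadj with rfl | rfl | ⟨h1, -⟩
    · exact ⟨_, hR.2 ((hone c c.2 r r.2 hb).1 (hL.1 hv)), hne1 _ _, Or.inr (Or.inl rfl)⟩
    · exact ⟨_, hL.2 ((hone c c.2 r r.2 hb).2 (hR.1 hv)), (hne1 _ _).symm, Or.inl rfl⟩
    · simp only at h1; rw [hb] at h1; cases h1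
  | false =>
    let r' : Fin (2 ^ n) := ⟨r + 2 ^ (n - 1 - (c : ℕ)), shift_lt c.2 r.2 hb⟩
    have hU : ((r', c.castSucc) : VarNode n) ∈ S ↔ P c (r + 2 ^ (n - 1 - (c : ℕ))) := hS _
    have hadjU : Adj ((r', c.castSucc) : VarNode n) (r, c) := Or.inr (Or.inr ⟨hb, rfl, rfl⟩)
    have hne2 : ((r', c.castSucc) : VarNode n) ≠ (r, c.castSucc) := by
      intro he
      have := congrArg (fun v : VarNode n => (v.1 : ℕ)) he
      simp [r'] at this
    obtain ⟨z1, z2, z3⟩ := hzero c c.2 r r.2 hb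
    rcases hadj with rfl | rfl | ⟨-, h2, h3⟩
    · rcases z1 (hL.1 hv) with h | h
      · exact ⟨_, hU.2 h, hne2, hadjU⟩
      · exact ⟨_, hR.2 h, hne1 _ _, Or.inr (Or.inl rfl)⟩
    · rcases z3 (hR.1 hv) with h | h
      · exact ⟨_, hL.2 h, (hne1 _ _).symm, Or.inl rfl⟩
      · exact ⟨_, hU.2 h, (hne1 _ _).symm, hadjU⟩
    · have hv' : v = (r', c.castSucc) := Prod.ext (Fin.ext h3) h2
      subst hv'
      rcases z2 (hU.1 hv) with h | h
      · exact ⟨_, hL.2 h, hne2.symm, Or.inl rfl⟩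
      · exact ⟨_, hR.2 h, hne1 _ _, Or.inr (Or.inl rfl)⟩

theorem weight_add_two_pow_of_lt {m r q : ℕ} (hq : q < m) (hr : r.testBit q = false) :
    weight m (r + 2 ^ q) = weight m r + 1 := by
  have : ((Finset.range m).filter fun k => (r + 2 ^ q).testBit k = true) =
      insert q ((Finset.range m).filter fun k => r.testBit k = true) := by
    ext k
    simp only [Finset.mem_filter, Finset.mem_range, Finset.mem_insert, testBit_add_two_pow hr,
      Bool.or_eq_true, decide_eq_true_eq]
    constructor
    · rintro ⟨h1, h2⟩; tauto
    · rintro (rfl | h) <;> tauto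
  rw [weight, this, Finset.card_insert_of_notMem (by simp [hr]), weight]

theorem testBit_sub_two_pow {r p : ℕ} (h : r.testBit p = true) :
    2 ^ p ≤ r ∧ (r - 2 ^ p).testBit p = false := by
  have hle := Nat.ge_two_pow_of_testBit h
  refine ⟨hle, ?_⟩
  have h1 : (r - 2 ^ p) / 2 ^ p + 1 = r / 2 ^ p := by
    rw [← Nat.add_div_right _ (by positivity), Nat.sub_add_cancel hle]
  rw [Nat.testBit_eq_decide_div_mod_eq] at h ⊢
  have h := of_decide_eq_true h
  rw [decide_eq_false_iff_not]
  omega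

theorem testBit_eq_false_of_lt_two_pow {n r k : ℕ} (hr : r < 2 ^ n) (hk : n ≤ k) :
    r.testBit k = false :=
  Nat.testBit_lt_two_pow (hr.trans_le (Nat.pow_le_pow_right (by norm_num) hk))

theorem add_two_pow_lt {n r p : ℕ} (hr : r < 2 ^ n) (hp : p < n) (hb : r.testBit p = false) :
    r + 2 ^ p < 2 ^ n := by
  have h : n - 1 - (n - 1 - p) = p := by omega
  have := shift_lt (c := n - 1 - p) (by omega) hr (by rwa [h])
  rwa [h] at this

/-- Moving a digit `1` from position `p` to the empty position `p + 1` adds `2 ^ p`. -/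
theorem exists_eq_add_two_pow {r p : ℕ} (h : r.testBit p = true)
    (h' : r.testBit (p + 1) = false) : ∃ s, s.testBit p = false ∧ s.testBit (p + 1) = false ∧
      r = s + 2 ^ p ∧ r + 2 ^ p = s + 2 ^ (p + 1) := by
  obtain ⟨hle, h0⟩ := testBit_sub_two_pow h
  have hsplit : r = (r - 2 ^ p) + 2 ^ p := by omega
  refine ⟨r - 2 ^ p, h0, ?_, hsplit, by rw [pow_succ]; omega⟩
  rw [hsplit, testBit_add_two_pow h0] at h'
  simpa using h'

theorem add_two_pow_lt_of_shift {n r p : ℕ} (hr : r < 2 ^ n) (hp : p + 1 < n)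
    (h : r.testBit p = true) (h' : r.testBit (p + 1) = false) : r + 2 ^ p < 2 ^ n := by
  obtain ⟨s, -, hs, hrs, hsum⟩ := exists_eq_add_two_pow h h'
  rw [hsum]
  exact add_two_pow_lt ((Nat.le_add_right s _).trans_lt (hrs ▸ hr)) hp hs

/-- A set of rows is closed under two moves: turning a digit `0` into `1`, and moving a digit `1`
to the next higher position if that holds `0`. In both cases `2 ^ p` is added to the index. -/
structure MoveClosed {n : ℕ} (A : Finset (Fin (2 ^ n))) : Prop where
  flip : ∀ i ∈ A, ∀ (j : Fin (2 ^ n)) (p : ℕ), (i : ℕ).testBit p = false →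
    (j : ℕ) = i + 2 ^ p → j ∈ A
  shift : ∀ i ∈ A, ∀ (j : Fin (2 ^ n)) (p : ℕ), (i : ℕ).testBit p = true →
    (i : ℕ).testBit (p + 1) = false → (j : ℕ) = i + 2 ^ p → j ∈ A

theorem MoveClosed.mem_of_submask {n : ℕ} {A : Finset (Fin (2 ^ n))} (hA : MoveClosed A)
    {i j : Fin (2 ^ n)} (hi : i ∈ A)
    (hij : ∀ k, (i : ℕ).testBit k = true → (j : ℕ).testBit k = true) : j ∈ A := by
  classical
  -- the largest member of `A` below `j` in the digitwise order is `j`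
  obtain ⟨s, hs, hmax⟩ := Finset.exists_max_image
    (A.filter fun s : Fin (2 ^ n) => ∀ k, (s : ℕ).testBit k = true → (j : ℕ).testBit k = true) id
    ⟨i, Finset.mem_filter.2 ⟨hi, hij⟩⟩
  rw [Finset.mem_filter] at hs
  by_cases hsj : s = j
  · exact hsj ▸ hs.1
  obtain ⟨k, hk⟩ : ∃ k, (s : ℕ).testBit k ≠ (j : ℕ).testBit k := by
    by_contra! h
    exact hsj (Fin.ext (Nat.eq_of_testBit_eq h))
  have hsk : (s : ℕ).testBit k = false := by
    by_contra h
    rw [Bool.not_eq_false] at h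
    exact hk (by rw [h, hs.2 k h])
  have hjk : (j : ℕ).testBit k = true := by
    rw [hsk] at hk
    simpa using hk.symm
  have hkn : k < n := by
    by_contra h
    rw [testBit_eq_false_of_lt_two_pow j.2 (by omega)] at hjk
    cases hjk
  have := hmax ⟨s + 2 ^ k, add_two_pow_lt s.2 hkn hsk⟩ (Finset.mem_filter.2
    ⟨hA.flip s hs.1 _ k hsk rfl, fun l hl => by
      simp only [testBit_add_two_pow hsk, Bool.or_eq_true, decide_eq_true_eq] at hl
      rcases hl with rfl | hl
      · exact hjk
      · exact hs.2 l hl⟩)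
  rw [Fin.le_def] at this
  have : 0 < 2 ^ k := by positivity
  simp at *

/-- A member of weight `k` can be moved to `1⋯10⋯0` with `k` ones. -/
theorem MoveClosed.exists_compressed {n : ℕ} {A : Finset (Fin (2 ^ n))} (hA : MoveClosed A)
    {i : Fin (2 ^ n)} (hi : i ∈ A) :
    ∃ s ∈ A, ∀ k, (s : ℕ).testBit k = true → n - weight n i ≤ k := by
  classical
  obtain ⟨s, hs, hmax⟩ := Finset.exists_max_image
    (A.filter fun s : Fin (2 ^ n) => weight n s = weight n i) id
    ⟨i, Finset.mem_filter.2 ⟨hi, rfl⟩⟩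
  rw [Finset.mem_filter] at hs
  have hmono : ∀ p, p + 1 < n → (s : ℕ).testBit p = true → (s : ℕ).testBit (p + 1) = true := by
    intro p hp hb
    by_contra h
    rw [Bool.not_eq_true] at h
    obtain ⟨r, h0, h1, hsplit, hsum⟩ := exists_eq_add_two_pow hb h
    have hlt := add_two_pow_lt_of_shift s.2 hp hb h
    have hw : weight n ((s : ℕ) + 2 ^ p) = weight n i := by
      rw [hsum, weight_add_two_pow_of_lt hp h1, ← hs.2,
        ← weight_add_two_pow_of_lt (by omega : p < n) h0, ← hsplit]
    have := hmax ⟨s + 2 ^ p, hlt⟩ (Finset.mem_filter.2 ⟨hA.shift s hs.1 _ p hb h rfl, hw⟩)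
    rw [id, id, Fin.le_def] at this
    have : 0 < 2 ^ p := by positivity
    simp at *
  refine ⟨s, hs.1, fun k hk => ?_⟩
  have hkn : k < n := by
    by_contra h
    rw [testBit_eq_false_of_lt_two_pow s.2 (by omega)] at hk
    cases hk
  have hall : ∀ d, k + d < n → (s : ℕ).testBit (k + d) = true := by
    intro d
    induction d with
    | zero => exact fun _ => hk
    | succ d ih => exact fun h => hmono (k + d) h (ih (by omega))
  have : n - k ≤ weight n s := by
    rw [weight, ← Nat.card_Ico]
    refine Finset.card_le_card fun l hl => ?_
    rw [Finset.mem_Ico] at hl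
    obtain ⟨d, rfl⟩ := Nat.exists_eq_add_of_le hl.1
    exact Finset.mem_filter.2 ⟨Finset.mem_range.2 hl.2, hall d hl.2⟩
  rw [← hs.2]
  omega

theorem weight_le (m r : ℕ) : weight m r ≤ m := by
  unfold weight
  exact (Finset.card_filter_le _ _).trans (by simp)

/-- For a set closed under the moves, a member `i` of least weight `k` yields a `VSS` of size
`2 ^ k`: up to column `k` every row block is a copy of the part of `A` with `k` leading ones, which
fills the whole block at column `k`; afterwards one row survives in each block. -/
theorem MoveClosed.exists_isVSS {n : ℕ} {A : Finset (Fin (2 ^ n))} (hA : MoveClosed A)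
    {i : Fin (2 ^ n)} (hi : i ∈ A) : ∃ V, IsVSS A V ∧ V.card = leafCount i := by
  classical
  obtain ⟨s, hs, hsk⟩ := hA.exists_compressed hi
  rw [leafCount_eq]
  have hkn := weight_le n i
  generalize weight n i = k at *
  let Q : ℕ → ℕ → Prop := fun c r => ∃ a ∈ A, ∀ j < n,
    (j + c < n → (a : ℕ).testBit j = r.testBit j) ∧ (n ≤ j + c → (a : ℕ).testBit j = true)
  let R : ℕ → ℕ → Prop := fun c r => ∀ j, n ≤ j + c → j + k < n → r.testBit j = true
  let P : ℕ → ℕ → Prop := fun c r => if c < k then Q c r else R c r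
  have hQk : ∀ r, Q k r := by
    intro r
    have hlt : (r % 2 ^ (n - k)) + (2 ^ n - 2 ^ (n - k)) < 2 ^ n := by
      have := Nat.mod_lt r (show 0 < 2 ^ (n - k) by positivity)
      have : 2 ^ (n - k) ≤ 2 ^ n := Nat.pow_le_pow_right (by norm_num) (by omega)
      omega
    have hbit : ∀ j < n, ((r % 2 ^ (n - k)) + (2 ^ n - 2 ^ (n - k))).testBit j =
        if j < n - k then r.testBit j else true := by
      intro j hj
      have h2 : 2 ^ n - 2 ^ (n - k) = 2 ^ (n - k) * (2 ^ k - 1) := by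
        rw [Nat.mul_sub, ← pow_add, mul_one]; congr 2; omega
      rw [add_comm, h2, Nat.testBit_two_pow_mul_add _ (Nat.mod_lt r (by positivity))]
      split_ifs with h
      · rw [Nat.testBit_mod_two_pow]; simp [h]
      · rw [Nat.testBit_two_pow_sub_one]; simp; omega
    refine ⟨⟨_, hlt⟩, hA.mem_of_submask hs fun j hj => ?_, fun j hj => ⟨fun h => ?_, fun h => ?_⟩⟩
    · have hjn : j < n := by
        by_contra h
        rw [testBit_eq_false_of_lt_two_pow s.2 (by omega)] at hj
        cases hj
      have := hsk j hj
      simp only [hbit j hjn, if_neg (show ¬ j < n - k by omega)]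
    · simp only [hbit j hj, if_pos (show j < n - k by omega)]
    · simp only [hbit j hj, if_neg (show ¬ j < n - k by omega)]
  have hRk : ∀ r, R k r := fun r j h1 h2 => by omega
  have hPQ : ∀ c ≤ k, ∀ r, P c r ↔ Q c r := by
    intro c hc r
    simp only [P]
    split_ifs with h
    · rfl
    · obtain rfl : c = k := by omega
      exact ⟨fun _ => hQk r, fun _ => hRk r⟩
  have hPR : ∀ c, k ≤ c → ∀ r, P c r ↔ R c r := fun c hc r => by
    simp only [P, if_neg (show ¬ c < k by omega)]
  have hQ0 : ∀ r : Fin (2 ^ n), Q 0 r ↔ r ∈ A := by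
    refine fun r => ⟨?_, fun hr => ⟨r, hr, fun j hj => ⟨fun _ => rfl, fun h => by omega⟩⟩⟩
    rintro ⟨a, ha, har⟩
    have : a = r := by
      refine Fin.ext (Nat.eq_of_testBit_eq fun j => ?_)
      by_cases hj : j < n
      · exact (har j hj).1 (by omega)
      · rw [testBit_eq_false_of_lt_two_pow a.2 (by omega),
          testBit_eq_false_of_lt_two_pow r.2 (by omega)]
    exact this ▸ ha
  -- passing to the next column forgets one digit, which must then be `1`
  have hQone : ∀ c < n, ∀ r : ℕ, r.testBit (n - 1 - c) = true → (Q c r ↔ Q (c + 1) r) := by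
    intro c hc r hr
    refine exists_congr fun a => and_congr_right fun _ => ⟨fun h j hj => ⟨fun h1 => ?_, fun h1 => ?_⟩,
      fun h j hj => ⟨fun h1 => ?_, fun h1 => (h j hj).2 (by omega)⟩⟩
    · exact (h j hj).1 (by omega)
    · by_cases h2 : n ≤ j + c
      · exact (h j hj).2 h2
      · rw [(h j hj).1 (by omega), show j = n - 1 - c by omega, hr]
    · by_cases h2 : j = n - 1 - c
      · rw [(h j hj).2 (by omega), h2, hr]
      · exact (h j hj).1 (by omega)
  have hQup : ∀ c < n, ∀ r : ℕ, r.testBit (n - 1 - c) = false →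
      (Q c (r + 2 ^ (n - 1 - c)) ↔ Q (c + 1) r) := by
    intro c hc r hr
    rw [hQone c hc _ (by rw [testBit_add_two_pow hr]; simp)]
    refine exists_congr fun a => and_congr_right fun _ => forall₂_congr fun j hj =>
      and_congr_left fun _ => forall_congr' fun h => ?_
    rw [testBit_add_two_pow hr]
    simp [show j ≠ n - 1 - c by omega]
  have hQmono : ∀ c < n, ∀ r : ℕ, r.testBit (n - 1 - c) = false → Q c r → Q (c + 1) r := by
    rintro c hc r hr ⟨a, ha, har⟩
    have hab : (a : ℕ).testBit (n - 1 - c) = false := by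
      rw [(har _ (by omega)).1 (by omega), hr]
    refine ⟨⟨a + 2 ^ (n - 1 - c), shift_lt hc a.2 hab⟩, hA.flip a ha _ _ hab rfl,
      fun j hj => ⟨fun h => ?_, fun h => ?_⟩⟩
    · simp only [testBit_add_two_pow hab, (har j hj).1 (by omega)]
      simp [show j ≠ n - 1 - c by omega]
    · simp only [testBit_add_two_pow hab, Bool.or_eq_true, decide_eq_true_eq]
      by_cases h2 : j = n - 1 - c
      · exact Or.inl h2
      · exact Or.inr ((har j hj).2 (by omega))
  let S : Finset (VarNode n) := Finset.univ.filter fun v => P v.2 v.1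
  have hmem : ∀ v : VarNode n, v ∈ S ↔ P v.2 v.1 := fun v => by simp [S]
  have hP0 : ∀ r : Fin (2 ^ n), P 0 r ↔ r ∈ A := fun r => (hPQ 0 (by omega) r).trans (hQ0 r)
  refine ⟨observedNodes S, ⟨S, isStoppingSet_of_column P ⟨i, i.2, (hP0 i).2 hi⟩ ?_ ?_ S hmem, ?_,
    rfl⟩, ?_⟩
  · intro c hc r _ hb
    rcases lt_or_ge c k with hck | hck
    · rw [hPQ c hck.le, hPQ (c + 1) hck]
      exact hQone c hc r hb
    · rw [hPR c hck, hPR (c + 1) (by omega)]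
      refine ⟨fun h j h1 h2 => ?_, fun h j h1 h2 => h j (by omega) h2⟩
      by_cases h3 : n ≤ j + c
      · exact h j h3 h2
      · rw [show j = n - 1 - c by omega, hb]
  · intro c hc r _ hb
    rcases lt_or_ge c k with hck | hck
    · rw [hPQ c hck.le, hPQ c hck.le, hPQ (c + 1) hck, hQup c hc r hb]
      exact ⟨fun h => Or.inl (hQmono c hc r hb h), fun h => Or.inr h, fun h => Or.inr h⟩
    · have hiff : P c (r + 2 ^ (n - 1 - c)) ↔ P c r := by
        rw [hPR c hck, hPR c hck]
        refine forall₃_congr fun j h1 h2 => ?_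
        rw [testBit_add_two_pow hb]
        simp [show j ≠ n - 1 - c by omega]
      have hno : ¬ P (c + 1) r := by
        rw [hPR (c + 1) (by omega)]
        intro h
        rw [h (n - 1 - c) (by omega) (by omega)] at hb
        cases hb
      tauto
  · ext r
    simp only [infoNodes, Finset.mem_filter, Finset.mem_univ, true_and, hmem]
    exact hP0 r
  · -- in the last column the `n - k` lowest digits are `1` and the others are free
    have hlast : ∀ r : Fin (2 ^ n), r ∈ observedNodes S ↔
        ∀ j, j + k < n → (r : ℕ).testBit j = true := by
      intro r
      simp only [observedNodes, Finset.mem_filter, Finset.mem_univ, true_and, hmem]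
      refine (hPR _ (by simpa using hkn) r).trans ?_
      exact forall_congr' fun j => by simp
    have hpow : 2 ^ n = 2 ^ (n - k) * 2 ^ k := by rw [← pow_add]; congr 1; omega
    rw [← Finset.card_range (2 ^ k)]
    symm
    refine Finset.card_bij (fun q hq => ⟨2 ^ (n - k) * q + (2 ^ (n - k) - 1), ?_⟩) ?_ ?_ ?_
    · have hq := Finset.mem_range.1 hq
      have h1 : 2 ^ (n - k) * (q + 1) ≤ 2 ^ n := by
        rw [hpow]; exact Nat.mul_le_mul_left _ hq
      have : 0 < 2 ^ (n - k) := by positivity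
      rw [mul_add] at h1
      omega
    · intro q hq
      rw [hlast]
      intro j hj
      have hlt : 2 ^ (n - k) - 1 < 2 ^ (n - k) := Nat.sub_lt (by positivity) one_pos
      simp only [Nat.testBit_two_pow_mul_add _ hlt, if_pos (show j < n - k by omega),
        Nat.testBit_two_pow_sub_one]
      simp; omega
    · intro q _ q' _ h
      have h := congrArg Fin.val h
      simp only at h
      exact Nat.eq_of_mul_eq_mul_left (show 0 < 2 ^ (n - k) by positivity) (by omega)
    · intro r hr
      rw [hlast] at hr
      have hmod : (r : ℕ) % 2 ^ (n - k) = 2 ^ (n - k) - 1 := by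
        refine Nat.eq_of_testBit_eq fun j => ?_
        rw [Nat.testBit_mod_two_pow, Nat.testBit_two_pow_sub_one]
        by_cases hj : j < n - k
        · simp [hj, hr j (by omega)]
        · simp [hj]
      refine ⟨r / 2 ^ (n - k), ?_, Fin.ext ?_⟩
      · rw [Finset.mem_range]
        exact Nat.div_lt_of_lt_mul (by rw [← hpow]; exact r.2)
      · simp only
        rw [← hmod, Nat.div_add_mod]

theorem MoveClosed.isMVSS {n : ℕ} {A : Finset (Fin (2 ^ n))} (hA : MoveClosed A)
    (hne : A.Nonempty) :
    (∃ V, IsMVSS A V) ∧ ∀ V, IsMVSS A V → V.card = A.inf' hne leafCount := by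
  obtain ⟨i, hi, hmin⟩ := Finset.exists_mem_eq_inf' hne leafCount
  obtain ⟨V₀, hV₀, hcard⟩ := hA.exists_isVSS hi
  have hle : ∀ V, IsVSS A V → A.inf' hne leafCount ≤ V.card := fun V hV => by
    obtain ⟨j, hj, hle⟩ := hV.exists_leafCount_le hne
    exact (Finset.inf'_le _ hj).trans hle
  refine ⟨⟨V₀, hV₀, fun V' hV' => ?_⟩, fun V hV => le_antisymm ?_ (hle V hV.1)⟩
  · rw [hcard, ← hmin]
    exact hle V' hV'
  · rw [hmin, ← hcard]
    exact hV.2 V₀ hV₀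

/-! ### Symmetric concave homogeneous functions of two likelihoods -/

/-- Functions of a pair of likelihoods `(W(y | 0), W(y | 1))` that are symmetric, homogeneous of
degree one and superadditive on the quadrant; homogeneity makes superadditivity the same as
concavity. They measure how unreliable an observation with these likelihoods is. -/
structure SymmConcave (h : ℝ → ℝ → ℝ) : Prop where
  measurable : Measurable (Function.uncurry h)
  smul : ∀ t a b, 0 ≤ t → 0 ≤ a → 0 ≤ b → h (t * a) (t * b) = t * h a b
  symm : ∀ a b, 0 ≤ a → 0 ≤ b → h a b = h b a
  superadd : ∀ a b a' b', 0 ≤ a → 0 ≤ b → 0 ≤ a' → 0 ≤ b' →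
    h a b + h a' b' ≤ h (a + a') (b + b')

namespace SymmConcave

variable {h k : ℝ → ℝ → ℝ}

theorem congr (hk : SymmConcave k) (hm : Measurable (Function.uncurry h))
    (he : ∀ a b, 0 ≤ a → 0 ≤ b → h a b = k a b) : SymmConcave h where
  measurable := hm
  smul t a b ht ha hb := by
    rw [he _ _ (mul_nonneg ht ha) (mul_nonneg ht hb), he a b ha hb, hk.smul t a b ht ha hb]
  symm a b ha hb := by rw [he a b ha hb, he b a hb ha, hk.symm a b ha hb]
  superadd a b a' b' ha hb ha' hb' := by
    rw [he a b ha hb, he a' b' ha' hb', he _ _ (add_nonneg ha ha') (add_nonneg hb hb')]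
    exact hk.superadd a b a' b' ha hb ha' hb'

/-- Superadditivity and symmetry bound `h a b` by multiples of `h 1 1` above and `h 1 0` below. -/
theorem abs_le (hh : SymmConcave h) : ∃ C : ℝ, ∀ a b, 0 ≤ a → 0 ≤ b → |h a b| ≤ C * (a + b) := by
  refine ⟨|h 1 1| + |h 1 0|, fun a b ha hb => ?_⟩
  have h1 := hh.superadd a b b a ha hb hb ha
  rw [← hh.symm a b ha hb, show b + a = (a + b) by ring] at h1
  have h2 := hh.smul (a + b) 1 1 (by positivity) zero_le_one zero_le_one
  rw [mul_one] at h2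
  have h3 := hh.superadd a 0 0 b ha le_rfl le_rfl hb
  rw [add_zero, zero_add, hh.symm 0 b le_rfl hb] at h3
  have h4 := hh.smul a 1 0 ha zero_le_one le_rfl
  have h5 := hh.smul b 1 0 hb zero_le_one le_rfl
  rw [mul_one, mul_zero] at h4 h5
  have h6 : (a + b) * h 1 1 ≤ (a + b) * |h 1 1| :=
    mul_le_mul_of_nonneg_left (le_abs_self _) (by positivity)
  have h7 : -((a + b) * |h 1 0|) ≤ (a + b) * h 1 0 := by
    rw [← mul_neg]; exact mul_le_mul_of_nonneg_left (neg_abs_le _) (by positivity)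
  have h8 : 0 ≤ (a + b) * |h 1 1| := by positivity
  have h9 : 0 ≤ (a + b) * |h 1 0| := by positivity
  rw [_root_.abs_le]
  constructor <;> nlinarith

theorem integrable {X : Type*} [MeasurableSpace X] {μ : Measure X} (hh : SymmConcave h)
    {f g : X → ℝ} (hfm : Measurable f) (hgm : Measurable g) (hf : Integrable f μ)
    (hg : Integrable g μ) (hf0 : ∀ x, 0 ≤ f x) (hg0 : ∀ x, 0 ≤ g x) :
    Integrable (fun x => h (f x) (g x)) μ := by
  obtain ⟨C, hC⟩ := hh.abs_le
  refine Integrable.mono' ((hf.add hg).const_mul C)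
    (hh.measurable.comp (hfm.prodMk hgm)).aestronglyMeasurable (.of_forall fun x => ?_)
  exact hC _ _ (hf0 x) (hg0 x)

end SymmConcave

/-- The harmonic function `ab / (a + b)`, with value `0` at the origin. Its superadditivity defect is
the explicit rational function in `harm_gap`, which makes it convenient for tracking strictness. -/
def harm (a b : ℝ) : ℝ := a * b / (a + b)

theorem measurable_harm : Measurable (Function.uncurry harm) := by
  unfold harm Function.uncurry
  fun_prop

theorem harm_zero : harm 0 0 = 0 := by simp [harm]

theorem harm_gap {a b a' b' : ℝ} (h : 0 < a + b) (h' : 0 < a' + b') :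
    harm (a + a') (b + b') = harm a b + harm a' b' +
      (a * b' - a' * b) ^ 2 / ((a + b) * (a' + b') * (a + b + (a' + b'))) := by
  unfold harm
  have h3 : a + a' + (b + b') ≠ 0 := by linarith
  have h4 : a + b + (a' + b') ≠ 0 := by linarith
  field_simp
  ring

/-- Superadditivity needs to be checked only away from the origin. -/
theorem superadd_of_pos {h : ℝ → ℝ → ℝ} (h0 : h 0 0 = 0)
    (hpos : ∀ a b a' b', 0 ≤ a → 0 ≤ b → 0 ≤ a' → 0 ≤ b' → 0 < a + b → 0 < a' + b' →
      h a b + h a' b' ≤ h (a + a') (b + b'))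
    (a b a' b' : ℝ) (ha : 0 ≤ a) (hb : 0 ≤ b) (ha' : 0 ≤ a') (hb' : 0 ≤ b') :
    h a b + h a' b' ≤ h (a + a') (b + b') := by
  rcases (add_nonneg ha hb).eq_or_lt with h1 | h1
  · obtain rfl : a = 0 := by linarith
    obtain rfl : b = 0 := by linarith
    simp [h0]
  rcases (add_nonneg ha' hb').eq_or_lt with h2 | h2
  · obtain rfl : a' = 0 := by linarith
    obtain rfl : b' = 0 := by linarith
    simp [h0]
  exact hpos a b a' b' ha hb ha' hb' h1 h2

theorem harm_smul (t a b : ℝ) : harm (t * a) (t * b) = t * harm a b := by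
  unfold harm
  rcases eq_or_ne t 0 with rfl | ht
  · simp
  · rw [← mul_add, show t * a * (t * b) = t * (t * (a * b)) by ring, mul_div_mul_left _ _ ht,
      mul_div_assoc]

theorem harm_symm (a b : ℝ) : harm a b = harm b a := by
  unfold harm; rw [mul_comm, add_comm]

theorem symmConcave_harm : SymmConcave harm where
  measurable := measurable_harm
  smul t a b _ _ _ := harm_smul t a b
  symm a b _ _ := harm_symm a b
  superadd := superadd_of_pos harm_zero fun a b a' b' _ _ _ _ h h' => by
    rw [harm_gap h h']
    have : 0 ≤ (a * b' - a' * b) ^ 2 / ((a + b) * (a' + b') * (a + b + (a' + b'))) := by positivity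
    linarith

theorem harm_superadd_lt {a b a' b' : ℝ} (ha : 0 ≤ a) (hb : 0 ≤ b) (ha' : 0 ≤ a') (hb' : 0 ≤ b')
    (hne : a * b' ≠ a' * b) : harm a b + harm a' b' < harm (a + a') (b + b') := by
  have h : 0 < a + b := by
    rcases (add_nonneg ha hb).eq_or_lt with h1 | h1
    · refine absurd ?_ hne
      rw [show a = 0 by linarith, show b = 0 by linarith]; simp
    · exact h1
  have h' : 0 < a' + b' := by
    rcases (add_nonneg ha' hb').eq_or_lt with h1 | h1
    · refine absurd ?_ hne
      rw [show a' = 0 by linarith, show b' = 0 by linarith]; simp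
    · exact h1
  rw [harm_gap h h']
  have h3 : 0 < (a * b' - a' * b) ^ 2 := by
    have := sub_ne_zero.2 hne
    positivity
  have : 0 < (a * b' - a' * b) ^ 2 / ((a + b) * (a' + b') * (a + b + (a' + b'))) := by positivity
  linarith

/-- The geometric mean is strictly more concave than the harmonic function. -/
theorem symmConcave_sqrt_sub_harm : SymmConcave fun a b => √(a * b) - harm a b where
  measurable := by
    refine Measurable.sub ?_ measurable_harm
    fun_prop
  smul t a b ht ha hb := by
    rw [harm_smul, show t * a * (t * b) = t ^ 2 * (a * b) by ring, Real.sqrt_mul (by positivity),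
      Real.sqrt_sq ht]
    ring
  symm a b _ _ := by rw [harm_symm, mul_comm]
  superadd := superadd_of_pos (by simp [harm_zero]) fun a b a' b' ha hb ha' hb' h h' => by
    rw [harm_gap h h']
    -- in terms of square roots, both defects are compared with `(x y' - x' y) ^ 2 / (w + w')`
    obtain ⟨x, hx, rfl⟩ : ∃ x, 0 ≤ x ∧ x ^ 2 = a := ⟨√a, Real.sqrt_nonneg a, Real.sq_sqrt ha⟩
    obtain ⟨y, hy, rfl⟩ : ∃ y, 0 ≤ y ∧ y ^ 2 = b := ⟨√b, Real.sqrt_nonneg b, Real.sq_sqrt hb⟩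
    obtain ⟨x', hx', rfl⟩ : ∃ x, 0 ≤ x ∧ x ^ 2 = a' := ⟨√a', Real.sqrt_nonneg a', Real.sq_sqrt ha'⟩
    obtain ⟨y', hy', rfl⟩ : ∃ y, 0 ≤ y ∧ y ^ 2 = b' := ⟨√b', Real.sqrt_nonneg b', Real.sq_sqrt hb'⟩
    have e1 : √(x ^ 2 * y ^ 2) = x * y := by
      rw [← mul_pow, Real.sqrt_sq (by positivity)]
    have e2 : √(x' ^ 2 * y' ^ 2) = x' * y' := by
      rw [← mul_pow, Real.sqrt_sq (by positivity)]
    rw [e1, e2]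
    set s := √((x ^ 2 + x' ^ 2) * (y ^ 2 + y' ^ 2)) with hs
    have hs0 : 0 ≤ s := Real.sqrt_nonneg _
    have hs2 : s ^ 2 = (x ^ 2 + x' ^ 2) * (y ^ 2 + y' ^ 2) := Real.sq_sqrt (by positivity)
    set w := x ^ 2 + y ^ 2 with hw
    set w' := x' ^ 2 + y' ^ 2 with hw'
    have hle : (x ^ 2 * y' ^ 2 - x' ^ 2 * y ^ 2) ^ 2 / (w * w' * (w + w')) ≤
        (x * y' - x' * y) ^ 2 / (w + w') := by
      rw [div_le_div_iff₀ (by positivity) (by positivity)]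
      have h1 : (x * y' + x' * y) ^ 2 ≤ w * w' := by
        rw [hw, hw']; nlinarith [sq_nonneg (x * x' - y * y')]
      have h2 : (x ^ 2 * y' ^ 2 - x' ^ 2 * y ^ 2) ^ 2 * (w + w') =
          (x * y' - x' * y) ^ 2 * ((x * y' + x' * y) ^ 2 * (w + w')) := by ring
      rw [h2]
      gcongr
    have hsP : x * y + x' * y' ≤ s := by
      refine Real.le_sqrt_of_sq_le ?_
      nlinarith [sq_nonneg (x * y' - x' * y)]
    have hsw : s ≤ (w + w') / 2 := by
      refine Real.sqrt_le_iff.2 ⟨by positivity, ?_⟩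
      rw [hw, hw']; nlinarith [sq_nonneg (x ^ 2 + x' ^ 2 - y ^ 2 - y' ^ 2)]
    have hPw : x * y + x' * y' ≤ (w + w') / 2 := by
      rw [hw, hw']; nlinarith [sq_nonneg (x - y), sq_nonneg (x' - y')]
    have hkey : (x * y' - x' * y) ^ 2 / (w + w') ≤ s - (x * y + x' * y') := by
      rw [div_le_iff₀ (by positivity)]
      have : (x * y' - x' * y) ^ 2 = (s - (x * y + x' * y')) * (s + (x * y + x' * y')) := by
        rw [← sub_eq_zero]; ring_nf; rw [hs2]; ring
      rw [this]
      refine mul_le_mul_of_nonneg_left (by linarith) (by linarith)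
    linarith

/-! ### The two elementary channel transforms acting on such functions -/

/-- The value of `h` on the pair of likelihoods obtained from `(a, b)` and `(c, d)` by the
transform `W⁻`. -/
def minusSlice (h : ℝ → ℝ → ℝ) (c d a b : ℝ) : ℝ :=
  h ((a * c + b * d) / 2) ((a * d + b * c) / 2)

/-- The sum of `h` over the two pairs of likelihoods obtained from `(a, b)` and `(c, d)` by the
transform `W⁺`. -/
def plusSlice (h : ℝ → ℝ → ℝ) (c d a b : ℝ) : ℝ :=
  h (a * c / 2) (b * d / 2) + h (b * c / 2) (a * d / 2)

section Slices

variable {h : ℝ → ℝ → ℝ} {a b c d : ℝ}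

theorem SymmConcave.minusSlice (hh : SymmConcave h) (hc : 0 ≤ c) (hd : 0 ≤ d) :
    SymmConcave (minusSlice h c d) where
  measurable := hh.measurable.comp (g := Function.uncurry h)
    (f := fun p : ℝ × ℝ => ((p.1 * c + p.2 * d) / 2, (p.1 * d + p.2 * c) / 2)) (by fun_prop)
  smul t a b ht ha hb := by
    unfold Polar.minusSlice
    rw [← hh.smul t _ _ ht (by positivity) (by positivity)]
    congr 1 <;> ring
  symm a b ha hb := by
    unfold Polar.minusSlice
    rw [hh.symm _ _ (by positivity) (by positivity)]
    congr 1 <;> ring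
  superadd a b a' b' ha hb ha' hb' := by
    unfold Polar.minusSlice
    refine (hh.superadd _ _ _ _ (by positivity) (by positivity) (by positivity)
      (by positivity)).trans_eq ?_
    congr 1 <;> ring

theorem SymmConcave.plusSlice (hh : SymmConcave h) (hc : 0 ≤ c) (hd : 0 ≤ d) :
    SymmConcave (plusSlice h c d) where
  measurable := (hh.measurable.comp (g := Function.uncurry h)
    (f := fun p : ℝ × ℝ => (p.1 * c / 2, p.2 * d / 2)) (by fun_prop)).add
    (hh.measurable.comp (g := Function.uncurry h)
    (f := fun p : ℝ × ℝ => (p.2 * c / 2, p.1 * d / 2)) (by fun_prop))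
  smul t a b ht ha hb := by
    unfold Polar.plusSlice
    rw [mul_add, ← hh.smul t _ _ ht (by positivity) (by positivity),
      ← hh.smul t _ _ ht (by positivity) (by positivity)]
    congr 2 <;> ring
  symm a b ha hb := by
    unfold Polar.plusSlice
    rw [add_comm]
  superadd a b a' b' ha hb ha' hb' := by
    unfold Polar.plusSlice
    have h1 := hh.superadd (a * c / 2) (b * d / 2) (a' * c / 2) (b' * d / 2) (by positivity)
      (by positivity) (by positivity) (by positivity)
    have h2 := hh.superadd (b * c / 2) (a * d / 2) (b' * c / 2) (a' * d / 2) (by positivity)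
      (by positivity) (by positivity) (by positivity)
    simp only [add_mul, add_div]
    linarith

theorem minusSlice_comm (h : ℝ → ℝ → ℝ) (a b c d : ℝ) :
    minusSlice h c d a b = minusSlice h a b c d := by
  unfold minusSlice
  congr 1 <;> ring

theorem SymmConcave.plusSlice_comm (hh : SymmConcave h) (ha : 0 ≤ a) (hb : 0 ≤ b) (hc : 0 ≤ c)
    (hd : 0 ≤ d) : Polar.plusSlice h c d a b = Polar.plusSlice h a b c d := by
  unfold Polar.plusSlice
  rw [hh.symm (b * c / 2) _ (by positivity) (by positivity), mul_comm a c, mul_comm b d,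
    mul_comm a d, mul_comm b c]

/-- Both sides are compared with `(c + d) / 2 * h a b`, the value of `h` when the observation
`(c, d)` is discarded. -/
theorem SymmConcave.plusSlice_le_minusSlice (hh : SymmConcave h) (ha : 0 ≤ a) (hb : 0 ≤ b)
    (hc : 0 ≤ c) (hd : 0 ≤ d) :
    Polar.plusSlice h c d a b ≤ (c + d) / 2 * h a b ∧
      (c + d) / 2 * h a b ≤ Polar.minusSlice h c d a b := by
  unfold Polar.plusSlice Polar.minusSlice
  constructor
  · rw [hh.symm (b * c / 2) _ (by positivity) (by positivity),
      ← hh.smul _ _ _ (by positivity) ha hb]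
    refine (hh.superadd _ _ _ _ (by positivity) (by positivity) (by positivity)
      (by positivity)).trans_eq ?_
    congr 1 <;> ring
  · have h1 := hh.superadd (c / 2 * a) (c / 2 * b) (d / 2 * b) (d / 2 * a) (by positivity)
      (by positivity) (by positivity) (by positivity)
    rw [hh.smul _ _ _ (by positivity) ha hb, hh.smul _ _ _ (by positivity) hb ha,
      hh.symm b a hb ha] at h1
    have h2 : (c / 2 * a + d / 2 * b) = (a * c + b * d) / 2 := by ring
    have h3 : (c / 2 * b + d / 2 * a) = (a * d + b * c) / 2 := by ring
    rw [h2, h3] at h1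
    linarith

/-- The discarded observation `(c, d)` is informative, and `(a, b)` leaves both inputs possible. -/
theorem plusSlice_harm_lt (ha : 0 < a) (hb : 0 < b) (hc : 0 ≤ c) (hd : 0 ≤ d) (hcd : c ≠ d) :
    plusSlice harm c d a b < minusSlice harm c d a b := by
  refine lt_of_lt_of_le ?_ (symmConcave_harm.plusSlice_le_minusSlice ha.le hb.le hc hd).2
  have hlt := harm_superadd_lt (a := a * c / 2) (b := b * d / 2) (a' := a * d / 2)
    (b' := b * c / 2) (by positivity) (by positivity) (by positivity) (by positivity) (by
      intro h
      have h1 : (c - d) * (a * b * (c + d)) = 0 := by linear_combination 4 * h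
      rcases mul_eq_zero.1 h1 with h2 | h2
      · exact hcd (by linarith)
      · have h3 : c + d = 0 := by
          rcases mul_eq_zero.1 h2 with h3 | h3
          · exact absurd h3 (by positivity)
          · exact h3
        exact hcd (by linarith))
  have e : harm (a * c / 2 + a * d / 2) (b * d / 2 + b * c / 2) = (c + d) / 2 * harm a b := by
    rw [← harm_smul]; congr 1 <;> ring
  rw [e] at hlt
  unfold plusSlice
  rw [harm_symm (b * c / 2)]
  exact hlt

/-- The transform `W⁻` with an informative second observation keeps part of the strict concavity of
the harmonic function. -/
theorem symmConcave_minusSlice_sub (hc : 0 ≤ c) (hd : 0 ≤ d) (hcd : c ≠ d) :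
    ∃ κ : ℝ, 0 < κ ∧ SymmConcave fun a b => minusSlice harm c d a b - κ * harm a b := by
  have hpos : 0 < c + d := by
    rcases (add_nonneg hc hd).eq_or_lt with h | h
    · exact absurd (by linarith) hcd
    · exact h
  have hsq : 0 < (c - d) ^ 2 := by
    have := sub_ne_zero.2 hcd
    positivity
  have hlin : SymmConcave fun a b => c * d / (2 * (c + d)) * (a + b) :=
    { measurable := by unfold Function.uncurry; fun_prop
      smul := fun t a b _ _ _ => by ring
      symm := fun a b _ _ => by ring
      superadd := fun a b a' b' _ _ _ _ => le_of_eq (by ring) }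
  refine ⟨(c - d) ^ 2 / (2 * (c + d)), by positivity, hlin.congr
    ((symmConcave_harm.minusSlice hc hd).measurable.sub (measurable_harm.const_mul _))
    fun a b ha hb => ?_⟩
  unfold minusSlice harm
  rcases (add_nonneg ha hb).eq_or_lt with h | h
  · rw [show a = 0 by linarith, show b = 0 by linarith]; simp
  · have h2 : (a * c + b * d) / 2 + (a * d + b * c) / 2 ≠ 0 := by
      rw [show (a * c + b * d) / 2 + (a * d + b * c) / 2 = (a + b) * (c + d) / 2 by ring]
      positivity
    rw [show (a * c + b * d) / 2 + (a * d + b * c) / 2 = (a + b) * (c + d) / 2 by ring] at *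
    field_simp
    ring

/-- The transform `W⁺` with a second observation that leaves both inputs possible keeps part of the
strict concavity of the harmonic function. -/
theorem symmConcave_plusSlice_sub (hc : 0 < c) (hd : 0 < d) :
    ∃ κ : ℝ, 0 < κ ∧ SymmConcave fun a b => plusSlice harm c d a b - κ * harm a b := by
  have hP := symmConcave_harm.plusSlice hc.le hd.le
  refine ⟨(c * d) ^ 2 / (2 * (c + d) ^ 3), by positivity, ?_⟩
  refine
    { measurable := hP.measurable.sub (measurable_harm.const_mul _)
      smul := fun t a b ht ha hb => by rw [hP.smul t a b ht ha hb, harm_smul]; ring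
      symm := fun a b ha hb => by rw [hP.symm a b ha hb, harm_symm]
      superadd := superadd_of_pos (by simp [plusSlice, harm_zero]) ?_ }
  intro a b a' b' ha hb ha' hb' h h'
  have hpos : ∀ {a b : ℝ}, 0 ≤ a → 0 ≤ b → 0 < a + b → 0 < a * c / 2 + b * d / 2 := by
    intro a b ha hb h
    rcases ha.eq_or_lt with rfl | ha
    · have : 0 < b := by linarith
      positivity
    · positivity
  have hle : ∀ {a b : ℝ}, 0 ≤ a → 0 ≤ b → a * c / 2 + b * d / 2 ≤ (c + d) / 2 * (a + b) := by
    intro a b ha hb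
    nlinarith [mul_nonneg ha hd.le, mul_nonneg hb hc.le]
  have h1 := harm_gap (hpos ha hb h) (hpos ha' hb' h')
  have h2 := symmConcave_harm.superadd (b * c / 2) (a * d / 2) (b' * c / 2) (a' * d / 2)
    (by positivity) (by positivity) (by positivity) (by positivity)
  -- the first of the two terms of `plusSlice` alone provides the strict concavity
  have h3 : (c * d) ^ 2 / (2 * (c + d) ^ 3) *
      ((a * b' - a' * b) ^ 2 / ((a + b) * (a' + b') * (a + b + (a' + b')))) ≤
      (a * c / 2 * (b' * d / 2) - a' * c / 2 * (b * d / 2)) ^ 2 /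
      ((a * c / 2 + b * d / 2) * (a' * c / 2 + b' * d / 2) *
        (a * c / 2 + b * d / 2 + (a' * c / 2 + b' * d / 2))) := by
    have e : (c * d) ^ 2 / (2 * (c + d) ^ 3) *
        ((a * b' - a' * b) ^ 2 / ((a + b) * (a' + b') * (a + b + (a' + b')))) =
        (a * c / 2 * (b' * d / 2) - a' * c / 2 * (b * d / 2)) ^ 2 /
        (((c + d) / 2 * (a + b)) * ((c + d) / 2 * (a' + b')) *
          ((c + d) / 2 * (a + b) + (c + d) / 2 * (a' + b'))) := by
      field_simp
    rw [e]
    have p1 := hpos ha hb h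
    have p2 := hpos ha' hb' h'
    have l1 := hle ha hb
    have l2 := hle ha' hb'
    gcongr
  have h4 := harm_gap h h'
  unfold plusSlice
  simp only [add_mul, add_div]
  rw [h4, h1]
  nlinarith [h2, h3]

end Slices

/-! ### Integration against a counting factor -/

theorem sum_zmod_two {M : Type*} [AddCommMonoid M] (f : ZMod 2 → M) : ∑ x, f x = f 0 + f 1 :=
  Fin.sum_univ_two f

theorem not_ae_not_prod {X X' : Type*} [MeasurableSpace X] [MeasurableSpace X'] {μ : Measure X}
    {ν : Measure X'} [SFinite ν]
    {p : X → Prop} {r : X' → Prop} (hp : ¬ ∀ᵐ x ∂μ, ¬ p x) (hr : ¬ ∀ᵐ x ∂ν, ¬ r x) :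
    ¬ ∀ᵐ z ∂μ.prod ν, ¬ (p z.1 ∧ r z.2) := by
  rw [ae_iff] at hp hr ⊢
  have : {z : X × X' | ¬ ¬ (p z.1 ∧ r z.2)} = {x | ¬ ¬ p x} ×ˢ {x | ¬ ¬ r x} := by
    ext z; simp
  rw [this, Measure.prod_prod]
  exact mul_ne_zero hp hr

theorem ae_of_ae_prod_count {X E : Type*} [MeasurableSpace X] [MeasurableSpace E] [Fintype E]
    [MeasurableSingletonClass E] {μ : Measure X} {p : X × E → Prop}
    (h : ∀ᵐ z ∂μ.prod Measure.count, p z) (e : E) :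
    ∀ᵐ x ∂μ, p (x, e) := by
  by_contra hx
  refine not_ae_not_prod (p := fun x => ¬ p (x, e)) (r := fun e' => e' = e)
    (ν := (Measure.count : Measure E)) (by simpa using hx) ?_ ?_
  · rw [ae_iff]
    simp
  · filter_upwards [h] with z hz hz'
    exact hz'.1 (hz'.2 ▸ hz)

section Count

variable {X E : Type*} [MeasurableSpace X] [MeasurableSpace E] [Fintype E]
  [MeasurableSingletonClass E] {μ : Measure X} [SFinite μ]

theorem integrable_prod_count {f : X × E → ℝ} (hf : Measurable f)
    (hi : ∀ e, Integrable (fun x => f (x, e)) μ) : Integrable f (μ.prod Measure.count) := by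
  rw [integrable_prod_iff' hf.aestronglyMeasurable]
  exact ⟨.of_forall hi, Integrable.of_finite⟩

theorem integral_prod_count {f : X × E → ℝ} (hf : Measurable f)
    (hi : ∀ e, Integrable (fun x => f (x, e)) μ) :
    ∫ z, f z ∂(μ.prod Measure.count) = ∫ x, ∑ e, f (x, e) ∂μ := by
  rw [integral_prod_symm _ (integrable_prod_count hf hi), integral_countable Integrable.of_finite,
    tsum_fintype, integral_finsetSum _ fun e _ => hi e]
  simp [measureReal_def]

end Count

theorem integral_lt_integral_of_le {X : Type*} [MeasurableSpace X] {μ : Measure X} {f g : X → ℝ}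
    (hf : Integrable f μ) (hg : Integrable g μ) (hle : ∀ x, f x ≤ g x)
    (hne : ¬ ∀ᵐ x ∂μ, ¬ f x < g x) : ∫ x, f x ∂μ < ∫ x, g x ∂μ := by
  refine lt_of_le_of_ne (integral_mono hf hg hle) fun he => hne ?_
  have h0 : ∫ x, (g x - f x) ∂μ = 0 := by rw [integral_sub hg hf, he, sub_self]
  have := (integral_eq_zero_iff_of_nonneg (fun x => sub_nonneg.2 (hle x)) (hg.sub hf)).1 h0
  filter_upwards [this] with x hx
  simp only [Pi.zero_apply] at hx
  linarith

theorem measurePreserving_prodProdProdComm {X₁ X₂ X₃ X₄ : Type*} [MeasurableSpace X₁]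
    [MeasurableSpace X₂] [MeasurableSpace X₃] [MeasurableSpace X₄] (μ₁ : Measure X₁)
    (μ₂ : Measure X₂) (μ₃ : Measure X₃) (μ₄ : Measure X₄) [SFinite μ₁] [SFinite μ₂] [SFinite μ₃]
    [SFinite μ₄] :
    MeasurePreserving (Equiv.prodProdProdComm X₁ X₂ X₃ X₄) ((μ₁.prod μ₂).prod (μ₃.prod μ₄))
      ((μ₁.prod μ₃).prod (μ₂.prod μ₄)) := by
  have h1 : MeasurePreserving (MeasurableEquiv.prodAssoc (α := X₁) (β := X₂) (γ := X₃ × X₄))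
      ((μ₁.prod μ₂).prod (μ₃.prod μ₄)) (μ₁.prod (μ₂.prod (μ₃.prod μ₄))) :=
    measurePreserving_prodAssoc _ _ _
  have h2 : MeasurePreserving (fun z : X₂ × X₃ × X₄ => (z.2.1, z.1, z.2.2))
      (μ₂.prod (μ₃.prod μ₄)) (μ₃.prod (μ₂.prod μ₄)) := by
    have h3 := (measurePreserving_prodAssoc μ₂ μ₃ μ₄).symm
    have h4 := (Measure.measurePreserving_swap (μ := μ₂) (ν := μ₃)).prod (MeasurePreserving.id μ₄)
    exact (measurePreserving_prodAssoc μ₃ μ₂ μ₄).comp (h4.comp h3)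
  exact (measurePreserving_prodAssoc μ₁ μ₃ (μ₂.prod μ₄)).symm.comp
    (((MeasurePreserving.id μ₁).prod h2).comp h1)

namespace BinaryChannel

variable {Y Y' Y₁ Y₂ : Type*} [MeasurableSpace Y] [MeasurableSpace Y'] [MeasurableSpace Y₁]
  [MeasurableSpace Y₂]

instance (W : BinaryChannel Y) : SigmaFinite W.ref := W.sigmaFinite_ref

/-! ### The elementary channel transforms -/

theorem integrable_mul_density (W : BinaryChannel Y) (V : BinaryChannel Y') (a b : ZMod 2) :
    Integrable (fun z : Y × Y' => W.density a z.1 * V.density b z.2) (W.ref.prod V.ref) :=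
  (W.integrable_density a).mul_prod (V.integrable_density b)

theorem integral_mul_density (W : BinaryChannel Y) (V : BinaryChannel Y') (a b : ZMod 2) :
    ∫ z : Y × Y', W.density a z.1 * V.density b z.2 ∂(W.ref.prod V.ref) = 1 := by
  rw [integral_prod_mul, W.integral_density, V.integral_density, one_mul]

theorem measurable_density_fst (W : BinaryChannel Y) (b : ZMod 2) :
    Measurable fun z : Y × Y' => W.density b z.1 := (W.measurable_density b).comp measurable_fst

theorem measurable_density_snd (W : BinaryChannel Y) (b : ZMod 2) :
    Measurable fun z : Y' × Y => W.density b z.2 := (W.measurable_density b).comp measurable_snd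

/-- The transform `W⁻`, for two possibly different channels: the input `b` is sent as `b + x` over
`W` and `x` over `V`, where `x` is a uniform bit. -/
def minus (W : BinaryChannel Y) (V : BinaryChannel Y') : BinaryChannel (Y × Y') where
  ref := W.ref.prod V.ref
  sigmaFinite_ref := inferInstance
  density b z := (∑ x, W.density (b + x) z.1 * V.density x z.2) / 2
  measurable_density b := (Finset.measurable_fun_sum _ fun x _ =>
    (W.measurable_density_fst _).mul (V.measurable_density_snd _)).div_const _
  density_nonneg b z := div_nonneg (Finset.sum_nonneg fun x _ =>
    mul_nonneg (W.density_nonneg _ _) (V.density_nonneg _ _)) zero_le_two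
  integral_density b := by
    rw [integral_div, integral_finsetSum _ fun x _ => W.integrable_mul_density V _ _]
    simp [integral_mul_density]

theorem measurable_plus_density (W : BinaryChannel Y) (V : BinaryChannel Y') (b : ZMod 2) :
    Measurable fun z : (Y × Y') × ZMod 2 => W.density (z.2 + b) z.1.1 * V.density b z.1.2 / 2 :=
  measurable_from_prod_countable_left fun a =>
    ((W.measurable_density_fst (a + b)).mul (V.measurable_density_snd b)).div_const _

/-- The transform `W⁺`, for two possibly different channels: the input `b` is sent as `a + b` over
`W` and `b` over `V`, where `a` is a uniform bit which is part of the output. -/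
def plus (W : BinaryChannel Y) (V : BinaryChannel Y') : BinaryChannel ((Y × Y') × ZMod 2) where
  ref := (W.ref.prod V.ref).prod Measure.count
  sigmaFinite_ref := inferInstance
  density b z := W.density (z.2 + b) z.1.1 * V.density b z.1.2 / 2
  measurable_density b := W.measurable_plus_density V b
  density_nonneg b z := div_nonneg (mul_nonneg (W.density_nonneg _ _) (V.density_nonneg _ _))
    zero_le_two
  integral_density b := by
    rw [integral_prod_count (W.measurable_plus_density V b)
      fun a => (W.integrable_mul_density V _ _).div_const _]
    dsimp only
    rw [integral_finsetSum _ fun a _ => (W.integrable_mul_density V _ _).div_const _]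
    simp [integral_div, integral_mul_density]

/-- The integral of a function of the two likelihoods over the output space. -/
def integral (W : BinaryChannel Y) (h : ℝ → ℝ → ℝ) : ℝ :=
  ∫ y, h (W.density 0 y) (W.density 1 y) ∂W.ref

theorem integrable (W : BinaryChannel Y) {h : ℝ → ℝ → ℝ} (hh : SymmConcave h) :
    Integrable (fun y => h (W.density 0 y) (W.density 1 y)) W.ref :=
  hh.integrable (W.measurable_density 0) (W.measurable_density 1) (W.integrable_density 0)
    (W.integrable_density 1) (W.density_nonneg 0) (W.density_nonneg 1)

theorem minus_density_zero (W : BinaryChannel Y) (V : BinaryChannel Y') (z : Y × Y') :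
    (W.minus V).density 0 z =
      (W.density 0 z.1 * V.density 0 z.2 + W.density 1 z.1 * V.density 1 z.2) / 2 := by
  simp [minus, sum_zmod_two]

theorem minus_density_one (W : BinaryChannel Y) (V : BinaryChannel Y') (z : Y × Y') :
    (W.minus V).density 1 z =
      (W.density 0 z.1 * V.density 1 z.2 + W.density 1 z.1 * V.density 0 z.2) / 2 := by
  simp [minus, sum_zmod_two, show (1 : ZMod 2) + 1 = 0 from rfl, add_comm]

variable {h : ℝ → ℝ → ℝ}

theorem minus_apply (W : BinaryChannel Y) (V : BinaryChannel Y') (z : Y × Y') :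
    h ((W.minus V).density 0 z) ((W.minus V).density 1 z) =
      minusSlice h (V.density 0 z.2) (V.density 1 z.2) (W.density 0 z.1) (W.density 1 z.1) := by
  rw [minus_density_zero, minus_density_one, minusSlice]

theorem plus_apply (W : BinaryChannel Y) (V : BinaryChannel Y') (z : Y × Y') :
    ∑ a, h ((W.plus V).density 0 (z, a)) ((W.plus V).density 1 (z, a)) =
      plusSlice h (V.density 0 z.2) (V.density 1 z.2) (W.density 0 z.1) (W.density 1 z.1) := by
  simp [plus, sum_zmod_two, plusSlice, show (1 : ZMod 2) + 1 = 0 from rfl]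

theorem integrable_minusSlice (W : BinaryChannel Y) (V : BinaryChannel Y') (hh : SymmConcave h) :
    Integrable (fun z : Y × Y' => minusSlice h (V.density 0 z.2) (V.density 1 z.2)
      (W.density 0 z.1) (W.density 1 z.1)) (W.ref.prod V.ref) :=
  ((W.minus V).integrable hh).congr (.of_forall fun z => W.minus_apply V z)

theorem integral_minus (W : BinaryChannel Y) (V : BinaryChannel Y') :
    (W.minus V).integral h = ∫ z : Y × Y', minusSlice h (V.density 0 z.2) (V.density 1 z.2)
      (W.density 0 z.1) (W.density 1 z.1) ∂(W.ref.prod V.ref) :=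
  integral_congr_ae (.of_forall fun z => W.minus_apply V z)

theorem integrable_plus_apply (W : BinaryChannel Y) (V : BinaryChannel Y') (hh : SymmConcave h)
    (a : ZMod 2) : Integrable (fun z : Y × Y' =>
      h ((W.plus V).density 0 (z, a)) ((W.plus V).density 1 (z, a))) (W.ref.prod V.ref) := by
  have hm : ∀ b, Measurable fun z : Y × Y' => (W.plus V).density b (z, a) := fun b =>
    ((W.plus V).measurable_density b).comp measurable_prodMk_right
  have hi : ∀ b, Integrable (fun z : Y × Y' => (W.plus V).density b (z, a)) (W.ref.prod V.ref) :=
    fun b => (W.integrable_mul_density V _ _).div_const _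
  exact hh.integrable (hm 0) (hm 1) (hi 0) (hi 1) (fun _ => (W.plus V).density_nonneg _ _)
    fun _ => (W.plus V).density_nonneg _ _

theorem measurable_apply (W : BinaryChannel Y) (hh : SymmConcave h) :
    Measurable fun y => h (W.density 0 y) (W.density 1 y) :=
  hh.measurable.comp ((W.measurable_density 0).prodMk (W.measurable_density 1))

theorem integrable_plusSlice (W : BinaryChannel Y) (V : BinaryChannel Y') (hh : SymmConcave h) :
    Integrable (fun z : Y × Y' => plusSlice h (V.density 0 z.2) (V.density 1 z.2)
      (W.density 0 z.1) (W.density 1 z.1)) (W.ref.prod V.ref) :=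
  (integrable_finsetSum _ fun a _ => W.integrable_plus_apply V hh a).congr
    (.of_forall fun z => W.plus_apply V z)

theorem integral_plus (W : BinaryChannel Y) (V : BinaryChannel Y') (hh : SymmConcave h) :
    (W.plus V).integral h = ∫ z : Y × Y', plusSlice h (V.density 0 z.2) (V.density 1 z.2)
      (W.density 0 z.1) (W.density 1 z.1) ∂(W.ref.prod V.ref) :=
  (integral_prod_count ((W.plus V).measurable_apply hh) (W.integrable_plus_apply V hh)).trans
    (integral_congr_ae (.of_forall fun z => W.plus_apply V z))

theorem integral_minus_comm (W : BinaryChannel Y) (V : BinaryChannel Y') :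
    (W.minus V).integral h = (V.minus W).integral h := by
  rw [integral_minus, integral_minus, ← integral_prod_swap]
  exact integral_congr_ae (.of_forall fun z => minusSlice_comm _ _ _ _ _)

theorem integral_plus_comm (W : BinaryChannel Y) (V : BinaryChannel Y') (hh : SymmConcave h) :
    (W.plus V).integral h = (V.plus W).integral h := by
  rw [integral_plus _ _ hh, integral_plus _ _ hh, ← integral_prod_swap]
  exact integral_congr_ae (.of_forall fun z => hh.plusSlice_comm (W.density_nonneg _ _)
    (W.density_nonneg _ _) (V.density_nonneg _ _) (V.density_nonneg _ _))

/-! ### Comparison of channels -/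

/-- `W₁` is at least as unreliable as `W₂`: every symmetric concave homogeneous function of the
likelihoods has at least as large an integral. For symmetric channels this is the degradation
order. -/
def Worse (W₁ : BinaryChannel Y₁) (W₂ : BinaryChannel Y₂) : Prop :=
  ∀ h, SymmConcave h → W₂.integral h ≤ W₁.integral h

/-- `W₁` is more unreliable than `W₂`, and strictly so for the harmonic function. -/
def StrictlyWorse (W₁ : BinaryChannel Y₁) (W₂ : BinaryChannel Y₂) : Prop :=
  W₁.Worse W₂ ∧ W₂.integral harm < W₁.integral harm

/-- The channel is neither completely noisy nor noiseless. Each part says that a set of outputs has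
positive measure: the outputs that are informative, and those that leave both inputs possible. -/
def Nondegenerate (W : BinaryChannel Y) : Prop :=
  (¬ ∀ᵐ y ∂W.ref, ¬ W.density 0 y ≠ W.density 1 y) ∧
    ¬ ∀ᵐ y ∂W.ref, ¬ (0 < W.density 0 y ∧ 0 < W.density 1 y)

theorem bhattacharyya_eq (W : BinaryChannel Y) :
    W.bhattacharyya = W.integral (fun a b => √(a * b) - harm a b) + W.integral harm := by
  rw [integral, integral, ← integral_add (W.integrable symmConcave_sqrt_sub_harm)
    (W.integrable symmConcave_harm)]
  simp [bhattacharyya]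

theorem StrictlyWorse.bhattacharyya_lt {W₁ : BinaryChannel Y₁} {W₂ : BinaryChannel Y₂}
    (hW : W₁.StrictlyWorse W₂) : W₂.bhattacharyya < W₁.bhattacharyya := by
  have h1 := hW.1 _ symmConcave_sqrt_sub_harm
  have h2 := hW.2
  rw [bhattacharyya_eq W₁, bhattacharyya_eq W₂]
  linarith

section Product

variable {W₁ : BinaryChannel Y₁} {W₂ : BinaryChannel Y₂} {V : BinaryChannel Y}
  {T : ℝ → ℝ → ℝ → ℝ → ℝ}

/-- Replacing the first factor of a product of channels by a better one. -/
theorem Worse.integral_slice_le (hW : W₁.Worse W₂)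
    (hT : ∀ c d, 0 ≤ c → 0 ≤ d → SymmConcave (T c d))
    (hi₁ : Integrable (fun z : Y₁ × Y => T (V.density 0 z.2) (V.density 1 z.2)
      (W₁.density 0 z.1) (W₁.density 1 z.1)) (W₁.ref.prod V.ref))
    (hi₂ : Integrable (fun z : Y₂ × Y => T (V.density 0 z.2) (V.density 1 z.2)
      (W₂.density 0 z.1) (W₂.density 1 z.1)) (W₂.ref.prod V.ref)) :
    ∫ z, T (V.density 0 z.2) (V.density 1 z.2) (W₂.density 0 z.1) (W₂.density 1 z.1)
        ∂(W₂.ref.prod V.ref) ≤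
      ∫ z, T (V.density 0 z.2) (V.density 1 z.2) (W₁.density 0 z.1) (W₁.density 1 z.1)
        ∂(W₁.ref.prod V.ref) := by
  rw [integral_prod_symm _ hi₁, integral_prod_symm _ hi₂]
  exact integral_mono hi₂.integral_prod_right hi₁.integral_prod_right fun y =>
    hW _ (hT _ _ (V.density_nonneg 0 y) (V.density_nonneg 1 y))

/-- Strictness survives when, with positive probability, the output of the second factor has the
property `p`, under which the slices of `T` retain a multiple of the harmonic function. -/
theorem StrictlyWorse.integral_slice_lt (hW : W₁.StrictlyWorse W₂)
    (hT : ∀ c d, 0 ≤ c → 0 ≤ d → SymmConcave (T c d))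
    (hi₁ : Integrable (fun z : Y₁ × Y => T (V.density 0 z.2) (V.density 1 z.2)
      (W₁.density 0 z.1) (W₁.density 1 z.1)) (W₁.ref.prod V.ref))
    (hi₂ : Integrable (fun z : Y₂ × Y => T (V.density 0 z.2) (V.density 1 z.2)
      (W₂.density 0 z.1) (W₂.density 1 z.1)) (W₂.ref.prod V.ref))
    {p : ℝ → ℝ → Prop} (hV : ¬ ∀ᵐ y ∂V.ref, ¬ p (V.density 0 y) (V.density 1 y))
    (hp : ∀ c d, 0 ≤ c → 0 ≤ d → p c d →
      ∃ κ : ℝ, 0 < κ ∧ SymmConcave fun a b => T c d a b - κ * harm a b) :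
    ∫ z, T (V.density 0 z.2) (V.density 1 z.2) (W₂.density 0 z.1) (W₂.density 1 z.1)
        ∂(W₂.ref.prod V.ref) <
      ∫ z, T (V.density 0 z.2) (V.density 1 z.2) (W₁.density 0 z.1) (W₁.density 1 z.1)
        ∂(W₁.ref.prod V.ref) := by
  rw [integral_prod_symm _ hi₁, integral_prod_symm _ hi₂]
  refine integral_lt_integral_of_le hi₂.integral_prod_right hi₁.integral_prod_right (fun y =>
    hW.1 _ (hT _ _ (V.density_nonneg 0 y) (V.density_nonneg 1 y))) fun hae => hV ?_
  filter_upwards [hae] with y hy hpy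
  have h0 := V.density_nonneg 0 y
  have h1 := V.density_nonneg 1 y
  obtain ⟨κ, hκ, hC⟩ := hp _ _ h0 h1 hpy
  have hle := hW.1 _ hC
  unfold integral at hle
  rw [integral_sub (W₁.integrable (hT _ _ h0 h1)) ((W₁.integrable symmConcave_harm).const_mul κ),
    integral_sub (W₂.integrable (hT _ _ h0 h1)) ((W₂.integrable symmConcave_harm).const_mul κ),
    integral_const_mul, integral_const_mul] at hle
  have hlt := mul_lt_mul_of_pos_left hW.2 hκ
  unfold integral at hlt
  exact hy (by linarith)

end Product

section Transforms

variable {W₁ : BinaryChannel Y₁} {W₂ : BinaryChannel Y₂}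

theorem StrictlyWorse.minus (hW : W₁.StrictlyWorse W₂) (h₁ : W₁.Nondegenerate) :
    (W₁.minus W₁).StrictlyWorse (W₂.minus W₂) := by
  -- the two factors are exchanged one after the other
  have second : ∀ {h : ℝ → ℝ → ℝ}, SymmConcave h →
      (W₂.minus W₂).integral h ≤ (W₂.minus W₁).integral h := by
    intro h hh
    rw [integral_minus_comm W₂ W₁, integral_minus, integral_minus]
    exact hW.1.integral_slice_le (fun _ _ hc hd => hh.minusSlice hc hd)
      (integrable_minusSlice _ _ hh) (integrable_minusSlice _ _ hh)
  refine ⟨fun h hh => (second hh).trans ?_, (second symmConcave_harm).trans_lt ?_⟩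
  · rw [integral_minus, integral_minus]
    exact hW.1.integral_slice_le (fun _ _ hc hd => hh.minusSlice hc hd)
      (integrable_minusSlice _ _ hh) (integrable_minusSlice _ _ hh)
  · have hh := symmConcave_harm
    rw [integral_minus, integral_minus]
    exact hW.integral_slice_lt (fun _ _ hc hd => hh.minusSlice hc hd)
      (integrable_minusSlice _ _ hh) (integrable_minusSlice _ _ hh) (p := fun c d => c ≠ d) h₁.1
      fun c d hc hd hcd => symmConcave_minusSlice_sub hc hd hcd

theorem StrictlyWorse.plus (hW : W₁.StrictlyWorse W₂) (h₁ : W₁.Nondegenerate) :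
    (W₁.plus W₁).StrictlyWorse (W₂.plus W₂) := by
  have second : ∀ {h : ℝ → ℝ → ℝ}, SymmConcave h →
      (W₂.plus W₂).integral h ≤ (W₂.plus W₁).integral h := by
    intro h hh
    rw [integral_plus_comm W₂ W₁ hh, integral_plus _ _ hh, integral_plus _ _ hh]
    exact hW.1.integral_slice_le (fun _ _ hc hd => hh.plusSlice hc hd)
      (integrable_plusSlice _ _ hh) (integrable_plusSlice _ _ hh)
  refine ⟨fun h hh => (second hh).trans ?_, (second symmConcave_harm).trans_lt ?_⟩
  · rw [integral_plus _ _ hh, integral_plus _ _ hh]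
    exact hW.1.integral_slice_le (fun _ _ hc hd => hh.plusSlice hc hd)
      (integrable_plusSlice _ _ hh) (integrable_plusSlice _ _ hh)
  · have hh := symmConcave_harm
    rw [integral_plus _ _ hh, integral_plus _ _ hh]
    exact hW.integral_slice_lt (fun _ _ hc hd => hh.plusSlice hc hd)
      (integrable_plusSlice _ _ hh) (integrable_plusSlice _ _ hh)
      (p := fun c d => 0 < c ∧ 0 < d) h₁.2
      fun c d _ _ hcd => symmConcave_plusSlice_sub hcd.1 hcd.2

variable {W : BinaryChannel Y}

theorem Nondegenerate.minus (hW : W.Nondegenerate) : (W.minus W).Nondegenerate := by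
  constructor
  · intro hae
    refine not_ae_not_prod hW.1 hW.1 ?_
    filter_upwards [show ∀ᵐ z ∂W.ref.prod W.ref, _ from hae] with z hz h
    refine hz fun he => ?_
    rw [minus_density_zero, minus_density_one] at he
    have := mul_ne_zero (sub_ne_zero.2 h.1) (sub_ne_zero.2 h.2)
    exact this (by linear_combination 2 * he)
  · intro hae
    refine not_ae_not_prod hW.2 hW.2 ?_
    filter_upwards [show ∀ᵐ z ∂W.ref.prod W.ref, _ from hae] with z hz h
    obtain ⟨⟨h1, h2⟩, h3, h4⟩ := h
    refine hz ?_
    rw [minus_density_zero, minus_density_one]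
    constructor <;> positivity

theorem Nondegenerate.plus (hW : W.Nondegenerate) : (W.plus W).Nondegenerate := by
  have e : (1 : ZMod 2) + 1 = 0 := rfl
  constructor
  · intro hae
    refine not_ae_not_prod hW.1 hW.2 ?_
    have h0 := ae_of_ae_prod_count (μ := W.ref.prod W.ref) hae 0
    have h1 := ae_of_ae_prod_count (μ := W.ref.prod W.ref) hae 1
    filter_upwards [h0, h1] with z hz0 hz1 ⟨h2, h3, h4⟩
    simp only [BinaryChannel.plus, add_zero, zero_add, e, not_not] at hz0 hz1
    have h5 : (W.density 0 z.1 - W.density 1 z.1) * (W.density 0 z.2 + W.density 1 z.2) = 0 := by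
      linear_combination 2 * hz0 - 2 * hz1
    rcases mul_eq_zero.1 h5 with h6 | h6
    · exact h2 (sub_eq_zero.1 h6)
    · linarith
  · intro hae
    refine not_ae_not_prod hW.2 hW.2 ?_
    have h0 := ae_of_ae_prod_count (μ := W.ref.prod W.ref) hae 0
    filter_upwards [h0] with z hz0 ⟨⟨h1, h2⟩, h3, h4⟩
    refine hz0 ?_
    simp only [BinaryChannel.plus, add_zero, zero_add]
    constructor <;> positivity

theorem Nondegenerate.of_bhattacharyya (hpos : 0 < W.bhattacharyya) (hlt : W.bhattacharyya < 1) :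
    W.Nondegenerate := by
  constructor
  · intro hae
    refine hlt.ne ?_
    rw [bhattacharyya, ← W.integral_density 0]
    refine integral_congr_ae ?_
    filter_upwards [hae] with y hy
    rw [not_not] at hy
    rw [← hy, Real.sqrt_mul_self (W.density_nonneg 0 y)]
  · intro hae
    refine hpos.ne' ?_
    rw [bhattacharyya, ← integral_zero Y ℝ (μ := W.ref)]
    refine integral_congr_ae ?_
    filter_upwards [hae] with y hy
    rcases (W.density_nonneg 0 y).eq_or_lt with h0 | h0
    · simp [← h0]
    rcases (W.density_nonneg 1 y).eq_or_lt with h1 | h1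
    · simp [← h1]
    exact absurd ⟨h0, h1⟩ hy

/-- `W⁻` is strictly worse than `W⁺`. -/
theorem Nondegenerate.minus_strictlyWorse_plus (hW : W.Nondegenerate) :
    (W.minus W).StrictlyWorse (W.plus W) := by
  have hle : ∀ {h : ℝ → ℝ → ℝ}, SymmConcave h → ∀ z : Y × Y,
      plusSlice h (W.density 0 z.2) (W.density 1 z.2) (W.density 0 z.1) (W.density 1 z.1) ≤
      minusSlice h (W.density 0 z.2) (W.density 1 z.2) (W.density 0 z.1) (W.density 1 z.1) := by
    intro h hh z
    have := hh.plusSlice_le_minusSlice (W.density_nonneg 0 z.1) (W.density_nonneg 1 z.1)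
      (W.density_nonneg 0 z.2) (W.density_nonneg 1 z.2)
    exact this.1.trans this.2
  refine ⟨fun h hh => ?_, ?_⟩
  · rw [integral_minus, integral_plus _ _ hh]
    exact integral_mono (integrable_plusSlice _ _ hh) (integrable_minusSlice _ _ hh) (hle hh)
  · have hh := symmConcave_harm
    rw [integral_minus, integral_plus _ _ hh]
    refine integral_lt_integral_of_le (integrable_plusSlice _ _ hh) (integrable_minusSlice _ _ hh)
      (hle hh) fun hae => not_ae_not_prod hW.2 hW.1 ?_
    filter_upwards [hae] with z hz ⟨⟨h1, h2⟩, h3⟩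
    exact hz (plusSlice_harm_lt h1 h2 (W.density_nonneg _ _) (W.density_nonneg _ _) h3)

end Transforms

end BinaryChannel

/-! ### Exchanging the two transforms -/

theorem integrable_section_of_prod_count {X E : Type*} [MeasurableSpace X] [MeasurableSpace E]
    [Fintype E] [MeasurableSingletonClass E] {μ : Measure X} [SFinite μ] {f : X × E → ℝ}
    (hf : Integrable f (μ.prod Measure.count)) (e : E) : Integrable (fun x => f (x, e)) μ := by
  have h := hf.prod_left_ae
  rw [Measure.ae_count_iff] at h
  exact h e

theorem count_prod_count {E E' : Type*} [MeasurableSpace E] [Fintype E] [MeasurableSpace E']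
    [Fintype E'] [MeasurableSingletonClass E] [MeasurableSingletonClass E'] :
    (Measure.count : Measure E).prod (Measure.count : Measure E') = Measure.count := by
  refine Measure.ext_of_singleton fun z => ?_
  rw [← Set.singleton_prod_singleton, Measure.prod_prod]
  simp

namespace BinaryChannel

variable {Y : Type*} [MeasurableSpace Y] {h : ℝ → ℝ → ℝ}

/-- The likelihoods of `W⁺⁻` for the outputs `y₁, y₃` and `y₂, y₄` of its two copies of `W⁺`. -/
def plusMinusDensity (W : BinaryChannel Y) (e : ZMod 2 × ZMod 2) (b : ZMod 2)
    (z : (Y × Y) × (Y × Y)) : ℝ :=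
  ((W.plus W).minus (W.plus W)).density b
    (((z.1.1, z.2.1), e.1), ((z.1.2, z.2.2), e.2))

theorem integral_plus_minus (W : BinaryChannel Y) (hh : SymmConcave h) :
    (∀ e, Integrable (fun z => h (W.plusMinusDensity e 0 z) (W.plusMinusDensity e 1 z))
      ((W.ref.prod W.ref).prod (W.ref.prod W.ref))) ∧
    ((W.plus W).minus (W.plus W)).integral h =
      ∫ z, ∑ e, h (W.plusMinusDensity e 0 z) (W.plusMinusDensity e 1 z)
        ∂((W.ref.prod W.ref).prod (W.ref.prod W.ref)) := by
  have hmp := (measurePreserving_prodProdProdComm (W.ref.prod W.ref) (W.ref.prod W.ref)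
    (Measure.count : Measure (ZMod 2)) (Measure.count : Measure (ZMod 2))).comp
    ((measurePreserving_prodProdProdComm W.ref W.ref W.ref W.ref).prod
      (MeasurePreserving.id ((Measure.count : Measure (ZMod 2)).prod Measure.count)))
  rw [count_prod_count] at hmp
  have hm := ((W.plus W).minus (W.plus W)).measurable_apply hh
  have hi := hmp.integrable_comp_of_integrable
    (((W.plus W).minus (W.plus W)).integrable hh)
  refine ⟨fun e => integrable_section_of_prod_count hi e, ?_⟩
  unfold integral
  rw [show ((W.plus W).minus (W.plus W)).ref = _ from hmp.map_eq.symm,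
    integral_map hmp.aemeasurable hm.aestronglyMeasurable]
  exact integral_prod_count (hm.comp hmp.measurable) fun e =>
    integrable_section_of_prod_count hi e

/-- An output of `W⁻⁺` arises from two outputs of `W⁺⁻` by forgetting all but the sum of the two
bits revealed by the copies of `W⁺`. -/
theorem minus_plus_density (W : BinaryChannel Y) (g b : ZMod 2) (z : (Y × Y) × (Y × Y)) :
    ((W.minus W).plus (W.minus W)).density b (z, g) =
      W.plusMinusDensity (g, 0) b z + W.plusMinusDensity (g + 1, 1) b z := by
  have e : (1 : ZMod 2) + 1 = 0 := rfl
  have hz : ∀ g : ZMod 2, g = 0 ∨ g = 1 := by decide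
  rcases hz g with rfl | rfl <;> rcases hz b with rfl | rfl <;>
    simp only [plusMinusDensity, minus, plus, sum_zmod_two, add_zero, zero_add, e] <;> ring

theorem sum_zmod_two_prod (f : ZMod 2 × ZMod 2 → ℝ) :
    ∑ e, f e = ∑ g, (f (g, 0) + f (g + 1, 1)) := by
  rw [Fintype.sum_prod_type]
  simp only [sum_zmod_two, zero_add, show (1 : ZMod 2) + 1 = 0 from rfl]
  ring

theorem plusMinusDensity_nonneg (W : BinaryChannel Y) (e : ZMod 2 × ZMod 2) (b : ZMod 2)
    (z : (Y × Y) × (Y × Y)) : 0 ≤ W.plusMinusDensity e b z :=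
  density_nonneg _ _ _

/-- The pairs of likelihoods merged in `minus_plus_density` are proportional for both values of
`g` only in degenerate situations. -/
theorem plusMinusDensity_cross_ne (W : BinaryChannel Y) (z : (Y × Y) × (Y × Y))
    (h₁ : W.density 0 z.1.1 ≠ W.density 1 z.1.1)
    (h₂ : 0 < W.density 0 z.1.2 ∧ 0 < W.density 1 z.1.2)
    (h₃ : 0 < W.density 0 z.2.1 ∧ 0 < W.density 1 z.2.1)
    (h₄ : W.density 0 z.2.2 ≠ W.density 1 z.2.2) :
    ∃ g, W.plusMinusDensity (g, 0) 0 z * W.plusMinusDensity (g + 1, 1) 1 z ≠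
      W.plusMinusDensity (g + 1, 1) 0 z * W.plusMinusDensity (g, 0) 1 z := by
  by_contra! hall
  have e : (1 : ZMod 2) + 1 = 0 := rfl
  have c0 := hall 0
  have c1 := hall 1
  simp only [plusMinusDensity, minus, plus, sum_zmod_two, add_zero, zero_add, e] at c0 c1
  have n1 := W.density_nonneg 0 z.1.1
  have n2 := W.density_nonneg 1 z.1.1
  have n3 := W.density_nonneg 0 z.2.2
  have n4 := W.density_nonneg 1 z.2.2
  have hne : ∀ {a b : ℝ}, 0 ≤ a → 0 ≤ b → a ≠ b → a ^ 2 - b ^ 2 ≠ 0 := by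
    intro a b ha hb hab h
    exact hab ((sq_eq_sq₀ ha hb).1 (by linarith))
  have hprod := mul_ne_zero (mul_ne_zero (hne n1 n2 h₁) (hne n3 n4 h₄))
    (mul_ne_zero (mul_pos h₂.1 h₂.2).ne' (mul_pos h₃.1 h₃.2).ne')
  -- the difference of the two cross products factors
  exact hprod (by linear_combination 32 * c0 - 32 * c1)

/-- `W⁻⁺` is strictly worse than `W⁺⁻`. -/
theorem Nondegenerate.minus_plus_strictlyWorse_plus_minus {W : BinaryChannel Y}
    (hW : W.Nondegenerate) : ((W.minus W).plus (W.minus W)).StrictlyWorse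
      ((W.plus W).minus (W.plus W)) := by
  have hnn := W.plusMinusDensity_nonneg
  have hleft : ∀ {h : ℝ → ℝ → ℝ}, SymmConcave h →
      Integrable (fun z => ∑ g, h (((W.minus W).plus (W.minus W)).density 0 (z, g))
        (((W.minus W).plus (W.minus W)).density 1 (z, g)))
        ((W.ref.prod W.ref).prod (W.ref.prod W.ref)) ∧
      ((W.minus W).plus (W.minus W)).integral h =
      ∫ z, ∑ g, h (((W.minus W).plus (W.minus W)).density 0 (z, g))
        (((W.minus W).plus (W.minus W)).density 1 (z, g))
        ∂((W.ref.prod W.ref).prod (W.ref.prod W.ref)) := fun hh =>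
    ⟨integrable_finsetSum _ fun g _ => integrable_plus_apply _ _ hh g,
      integral_prod_count (measurable_apply _ hh) (integrable_plus_apply _ _ hh)⟩
  have hle : ∀ {h : ℝ → ℝ → ℝ}, SymmConcave h → ∀ z,
      ∑ e, h (W.plusMinusDensity e 0 z) (W.plusMinusDensity e 1 z) ≤
      ∑ g, h (((W.minus W).plus (W.minus W)).density 0 (z, g))
        (((W.minus W).plus (W.minus W)).density 1 (z, g)) := by
    intro h hh z
    rw [sum_zmod_two_prod]
    refine Finset.sum_le_sum fun g _ => ?_
    rw [minus_plus_density, minus_plus_density]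
    exact hh.superadd _ _ _ _ (hnn _ _ _) (hnn _ _ _) (hnn _ _ _) (hnn _ _ _)
  refine ⟨fun h hh => ?_, ?_⟩
  · obtain ⟨hi, he⟩ := W.integral_plus_minus hh
    rw [he, (hleft hh).2]
    exact integral_mono (integrable_finsetSum _ fun e _ => hi e) (hleft hh).1 (hle hh)
  · have hh := symmConcave_harm
    obtain ⟨hi, he⟩ := W.integral_plus_minus hh
    rw [he, (hleft hh).2]
    refine integral_lt_integral_of_le (integrable_finsetSum _ fun e _ => hi e) (hleft hh).1
      (hle hh) fun hae => not_ae_not_prod (not_ae_not_prod hW.1 hW.2)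
        (not_ae_not_prod hW.2 hW.1) ?_
    filter_upwards [hae] with z hz ⟨⟨h1, h2⟩, h3, h4⟩
    refine hz ?_
    obtain ⟨g, hg⟩ := W.plusMinusDensity_cross_ne z h1 h2 h3 h4
    rw [sum_zmod_two_prod]
    refine Finset.sum_lt_sum (fun g _ => ?_) ⟨g, Finset.mem_univ g, ?_⟩
    · rw [minus_plus_density, minus_plus_density]
      exact hh.superadd _ _ _ _ (hnn _ _ _) (hnn _ _ _) (hnn _ _ _) (hnn _ _ _)
    · rw [minus_plus_density, minus_plus_density]
      exact harm_superadd_lt (hnn _ _ _) (hnn _ _ _) (hnn _ _ _) (hnn _ _ _) hg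

end BinaryChannel

/-! ### Recursive structure of the encoding map -/

theorem blockEquiv_val {n : ℕ} (a : Fin 2) (k : Fin (2 ^ n)) :
    (blockEquiv n (a, k) : ℕ) = k + 2 ^ n * a := by
  simp [blockEquiv, finProdFinEquiv]

/-- A word of length `2 ^ (n + 1)` is a pair of words of length `2 ^ n`. -/
def joinEquiv (n : ℕ) (R : Type*) :
    (Fin (2 ^ n) → R) × (Fin (2 ^ n) → R) ≃ (Fin (2 ^ (n + 1)) → R) :=
  (finTwoArrowEquiv _).symm.trans
    ((Equiv.curry _ _ _).symm.trans (Equiv.arrowCongr (blockEquiv n) (Equiv.refl _)))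

theorem joinEquiv_zero {n : ℕ} {R : Type*} (u v : Fin (2 ^ n) → R) (k : Fin (2 ^ n)) :
    joinEquiv n R (u, v) (blockEquiv n (0, k)) = u k := by
  simp [joinEquiv]

theorem joinEquiv_one {n : ℕ} {R : Type*} (u v : Fin (2 ^ n) → R) (k : Fin (2 ^ n)) :
    joinEquiv n R (u, v) (blockEquiv n (1, k)) = v k := by
  simp [joinEquiv]

/-- The recursion `(u, v) G = ((u + v) G', v G')` of the encoding map. -/
theorem encode_joinEquiv {n : ℕ} (u v : Fin (2 ^ n) → ZMod 2) :
    encode (n + 1) (joinEquiv n _ (u, v)) = joinEquiv n _ (encode n u + encode n v, encode n v) := by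
  ext j
  obtain ⟨⟨a, k⟩, rfl⟩ := (blockEquiv n).surjective j
  rw [encode, encodingMatrix, Matrix.vecMul, dotProduct, ← (blockEquiv n).sum_comp,
    Fintype.sum_prod_type, Fin.sum_univ_two]
  simp only [joinEquiv_zero, joinEquiv_one, Matrix.reindex_apply, Matrix.submatrix_apply,
    Equiv.symm_apply_apply, Matrix.kroneckerMap_apply, kernelMatrix]
  fin_cases a
  · simp [joinEquiv_zero, encode, Matrix.vecMul, dotProduct]
  · simp [joinEquiv_one, encode, Matrix.vecMul, dotProduct]

theorem encode_add (n : ℕ) (u v : Fin (2 ^ n) → ZMod 2) :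
    encode n (u + v) = encode n u + encode n v :=
  Matrix.add_vecMul _ _ _

theorem encode_encode : ∀ (n : ℕ) (u : Fin (2 ^ n) → ZMod 2), encode n (encode n u) = u
  | 0, u => by simp [encode, encodingMatrix]
  | n + 1, u => by
    obtain ⟨⟨v, w⟩, rfl⟩ := (joinEquiv n (ZMod 2)).surjective u
    rw [encode_joinEquiv, encode_joinEquiv, encode_add, encode_encode n v, encode_encode n w,
      add_assoc, CharTwo.add_self_eq_zero, add_zero]

/-- The encoding map is its own inverse. -/
def encodeEquiv (n : ℕ) : (Fin (2 ^ n) → ZMod 2) ≃ (Fin (2 ^ n) → ZMod 2) where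
  toFun := encode n
  invFun := encode n
  left_inv := encode_encode n
  right_inv := encode_encode n

/-- The indices before the index `i` of the first half. -/
def pastZeroEquiv {n : ℕ} (i : Fin (2 ^ n)) :
    {j : Fin (2 ^ n) // j < i} ≃ {j : Fin (2 ^ (n + 1)) // j < blockEquiv n (0, i)} :=
  Equiv.ofBijective (fun j => ⟨blockEquiv n (0, j), by
      have := j.2
      rw [Fin.lt_def] at this ⊢
      simpa [blockEquiv_val] using this⟩) (by
    constructor
    · rintro ⟨j, hj⟩ ⟨j', hj'⟩ h
      simpa using h
    · rintro ⟨j, hj⟩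
      obtain ⟨⟨a, k⟩, rfl⟩ := (blockEquiv n).surjective j
      rw [Fin.lt_def, blockEquiv_val, blockEquiv_val] at hj
      have hi := i.2
      fin_cases a
      · exact ⟨⟨k, by rw [Fin.lt_def]; simpa using hj⟩, rfl⟩
      · simp at hj; omega)

/-- The indices before the index `i` of the second half. -/
def pastOneEquiv {n : ℕ} (i : Fin (2 ^ n)) :
    Fin (2 ^ n) ⊕ {j : Fin (2 ^ n) // j < i} ≃
      {j : Fin (2 ^ (n + 1)) // j < blockEquiv n (1, i)} :=
  Equiv.ofBijective (Sum.elim (fun k => ⟨blockEquiv n (0, k), by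
      rw [Fin.lt_def, blockEquiv_val, blockEquiv_val]; simp; omega⟩)
      (fun j => ⟨blockEquiv n (1, j), by
      have := j.2
      rw [Fin.lt_def] at this ⊢
      simpa [blockEquiv_val] using this⟩)) (by
    constructor
    · rintro (k | ⟨j, hj⟩) (k' | ⟨j', hj'⟩) h
      · simpa using h
      · simp at h
      · simp at h
      · simpa using h
    · rintro ⟨j, hj⟩
      obtain ⟨⟨a, k⟩, rfl⟩ := (blockEquiv n).surjective j
      rw [Fin.lt_def, blockEquiv_val, blockEquiv_val] at hj
      fin_cases a
      · exact ⟨Sum.inl k, rfl⟩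
      · exact ⟨Sum.inr ⟨k, by rw [Fin.lt_def]; simpa using hj⟩, rfl⟩)

/-! ### Recursive structure of the bit-channels -/

theorem measurePreserving_count_equiv {E E' : Type*} [MeasurableSpace E] [Finite E]
    [MeasurableSpace E'] [MeasurableSingletonClass E] [MeasurableSingletonClass E'] (e : E ≃ E') :
    MeasurePreserving e (Measure.count : Measure E) (Measure.count : Measure E') := by
  have : Finite E' := Finite.of_equiv _ e
  refine ⟨measurable_of_finite e, Measure.ext_of_singleton fun x => ?_⟩
  rw [Measure.map_apply (measurable_of_finite e) (measurableSet_singleton x),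
    show e ⁻¹' {x} = {e.symm x} by ext y; simp [Equiv.eq_symm_apply]]
  simp

theorem pi_count (ι E : Type*) [Fintype ι] [MeasurableSpace E] [Fintype E]
    [MeasurableSingletonClass E] :
    (Measure.pi fun _ : ι => (Measure.count : Measure E)) = Measure.count := by
  classical
  refine Measure.ext_of_singleton fun x => ?_
  rw [Measure.pi_singleton]
  simp

/-- Pairing the two halves of a received word preserves the product measure. -/
theorem measurePreserving_joinEquiv {Y : Type*} [MeasurableSpace Y] (μ : Measure Y) [SigmaFinite μ]
    (n : ℕ) : MeasurePreserving
      (fun z : Fin (2 ^ n) → Y × Y => joinEquiv n Y (fun k => (z k).1, fun k => (z k).2))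
      (Measure.pi fun _ => μ.prod μ) (Measure.pi fun _ => μ) := by
  have hm : Measurable
      (fun z : Fin (2 ^ n) → Y × Y => joinEquiv n Y (fun k => (z k).1, fun k => (z k).2)) := by
    refine measurable_pi_iff.2 fun j => ?_
    obtain ⟨⟨a, k⟩, rfl⟩ := (blockEquiv n).surjective j
    fin_cases a
    · simp only [Fin.zero_eta, joinEquiv_zero]
      exact (measurable_pi_apply k).fst
    · simp only [Fin.mk_one, joinEquiv_one]
      exact (measurable_pi_apply k).snd
  refine ⟨hm, (Measure.pi_eq fun s hs => ?_).symm⟩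
  rw [Measure.map_apply hm (MeasurableSet.univ_pi hs)]
  have : (fun z : Fin (2 ^ n) → Y × Y => joinEquiv n Y (fun k => (z k).1, fun k => (z k).2)) ⁻¹'
      (Set.univ.pi s) =
      Set.univ.pi fun k => s (blockEquiv n (0, k)) ×ˢ s (blockEquiv n (1, k)) := by
    ext z
    simp only [Set.mem_preimage, Set.mem_univ_pi, Set.mem_prod]
    rw [← (blockEquiv n).forall_congr_right, Prod.forall, Fin.forall_fin_two, ← forall_and]
    simp only [joinEquiv_zero, joinEquiv_one]
  rw [this, Measure.pi_pi]
  simp only [Measure.prod_prod]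
  rw [← (blockEquiv n).prod_comp, Fintype.prod_prod_type, Fin.prod_univ_two,
    Finset.prod_mul_distrib]

namespace BinaryChannel

variable {Y Y₁ Y₂ : Type*} [MeasurableSpace Y] [MeasurableSpace Y₁] [MeasurableSpace Y₂]

theorem bhattacharyya_eq_of_measurePreserving {W₁ : BinaryChannel Y₁} {W₂ : BinaryChannel Y₂}
    (φ : Y₁ → Y₂) (hφ : MeasurePreserving φ W₁.ref W₂.ref)
    (hd : ∀ b y, W₂.density b (φ y) = W₁.density b y) : W₂.bhattacharyya = W₁.bhattacharyya := by
  have hm : Measurable fun y => √(W₂.density 0 y * W₂.density 1 y) :=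
    ((W₂.measurable_density 0).mul (W₂.measurable_density 1)).sqrt
  unfold bhattacharyya
  rw [← hφ.map_eq, integral_map hφ.aemeasurable hm.aestronglyMeasurable]
  simp only [hd]

theorem normalization_succ (n : ℕ) :
    ((2 : ℝ) ^ (2 ^ (n + 1) - 1))⁻¹ = ((2 : ℝ) ^ (2 ^ n - 1))⁻¹ * ((2 : ℝ) ^ 2 ^ n)⁻¹ := by
  rw [← mul_inv, ← pow_add]
  congr 2
  have : 0 < 2 ^ n := by positivity
  rw [pow_succ]
  omega

theorem sum_joinEquiv {n : ℕ} (f : (Fin (2 ^ (n + 1)) → ZMod 2) → ℝ) :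
    ∑ u, f u = ∑ v, ∑ w, f (joinEquiv n _ (v, w)) := by
  rw [← (joinEquiv n (ZMod 2)).sum_comp, Fintype.sum_prod_type]

theorem prod_joinEquiv (W : BinaryChannel Y) {n : ℕ} (u v : Fin (2 ^ n) → ZMod 2)
    (y y' : Fin (2 ^ n) → Y) :
    ∏ k, W.density (encode (n + 1) (joinEquiv n _ (u, v)) k) (joinEquiv n Y (y, y') k) =
      ∏ k, W.density (encode n u k + encode n v k) (y k) * W.density (encode n v k) (y' k) := by
  rw [← (blockEquiv n).prod_comp, Fintype.prod_prod_type, Fin.prod_univ_two,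
    Finset.prod_mul_distrib, encode_joinEquiv]
  simp only [joinEquiv_zero, joinEquiv_one, Pi.add_apply]

/-- For an index in the first half, the second half of the input is uniform and unknown, and so is its
encoded form: the bit-channel is one of `W⁻`. -/
theorem bhattacharyya_bitChannel_minus (W : BinaryChannel Y) (n : ℕ) (i : Fin (2 ^ n)) :
    (W.bitChannel (n + 1) (blockEquiv n (0, i))).bhattacharyya =
      ((W.minus W).bitChannel n i).bhattacharyya := by
  refine bhattacharyya_eq_of_measurePreserving
    (Prod.map (fun z : Fin (2 ^ n) → Y × Y => joinEquiv n Y (fun k => (z k).1, fun k => (z k).2))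
      (Equiv.arrowCongr (pastZeroEquiv i) (Equiv.refl (ZMod 2))))
    ((measurePreserving_joinEquiv W.ref n).prod (measurePreserving_count_equiv _)) ?_
  rintro b ⟨z, q⟩
  have hcond : ∀ u v : Fin (2 ^ n) → ZMod 2,
      (joinEquiv n (ZMod 2) (u, v) (blockEquiv n (0, i)) = b ∧
        (fun j : {j // j < blockEquiv n (0, i)} => joinEquiv n (ZMod 2) (u, v) j) =
          Equiv.arrowCongr (pastZeroEquiv i) (Equiv.refl (ZMod 2)) q) ↔
      (u i = b ∧ (fun j : {j // j < i} => u j) = q) := by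
    intro u v
    rw [joinEquiv_zero, ← Equiv.symm_apply_eq]
    refine and_congr_right fun _ => ?_
    rw [show (Equiv.arrowCongr (pastZeroEquiv i) (Equiv.refl (ZMod 2))).symm
      (fun j => joinEquiv n (ZMod 2) (u, v) j) = fun j : {j // j < i} => u j from
      funext fun j => joinEquiv_zero u v j]
  simp only [bitChannel, bitDensity, Prod.map_apply]
  rw [Finset.sum_filter, Finset.sum_filter, sum_joinEquiv, normalization_succ, mul_assoc]
  congr 1
  rw [Finset.mul_sum]
  refine Finset.sum_congr rfl fun u _ => ?_
  simp only [hcond, prod_joinEquiv]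
  split_ifs
  · simp only [minus, Finset.prod_div_distrib, Finset.prod_const, Finset.card_univ,
      Fintype.card_fin, Finset.prod_univ_sum, Fintype.piFinset_univ]
    rw [div_eq_inv_mul]
    congr 1
    exact (encodeEquiv n).sum_comp fun x : Fin (2 ^ n) → ZMod 2 =>
      ∏ k, W.density (encode n u k + x k) (z k).1 * W.density (x k) (z k).2
  · simp

/-- For an index in the second half, the first half of the input is known: the bit-channel is one of
`W⁺`. -/
theorem bhattacharyya_bitChannel_plus (W : BinaryChannel Y) (n : ℕ) (i : Fin (2 ^ n)) :
    (W.bitChannel (n + 1) (blockEquiv n (1, i))).bhattacharyya =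
      ((W.plus W).bitChannel n i).bhattacharyya := by
  -- the bits revealed by the copies of `W⁺` are the encoded first half of the past
  let past : (Fin (2 ^ n) → ZMod 2) × ({j : Fin (2 ^ n) // j < i} → ZMod 2) ≃
      ({j : Fin (2 ^ (n + 1)) // j < blockEquiv n (1, i)} → ZMod 2) :=
    ((encodeEquiv n).prodCongr (Equiv.refl _)).trans ((Equiv.sumArrowEquivProdArrow _ _ _).symm.trans
      (Equiv.arrowCongr (pastOneEquiv i) (Equiv.refl (ZMod 2))))
  have h1 := (measurePreserving_arrowProdEquivProdArrow (Y × Y) (ZMod 2) (Fin (2 ^ n))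
    (fun _ => W.ref.prod W.ref) (fun _ => Measure.count)).prod
    (MeasurePreserving.id (Measure.count : Measure ({j : Fin (2 ^ n) // j < i} → ZMod 2)))
  have h2 := measurePreserving_prodAssoc (Measure.pi fun _ : Fin (2 ^ n) => W.ref.prod W.ref)
    (Measure.pi fun _ : Fin (2 ^ n) => (Measure.count : Measure (ZMod 2)))
    (Measure.count : Measure ({j : Fin (2 ^ n) // j < i} → ZMod 2))
  rw [pi_count, count_prod_count] at h2
  rw [pi_count] at h1
  have h3 := (measurePreserving_joinEquiv W.ref n).prod (measurePreserving_count_equiv past)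
  refine bhattacharyya_eq_of_measurePreserving _ (h3.comp (h2.comp h1)) ?_
  rintro b ⟨z, q⟩
  have hcond : ∀ u v : Fin (2 ^ n) → ZMod 2,
      (joinEquiv n (ZMod 2) (u, v) (blockEquiv n (1, i)) = b ∧
        (fun j : {j // j < blockEquiv n (1, i)} => joinEquiv n (ZMod 2) (u, v) j) =
          past (fun k => (z k).2, q)) ↔
      (u = encode n (fun k => (z k).2) ∧ v i = b ∧ (fun j : {j // j < i} => v j) = q) := by
    intro u v
    rw [joinEquiv_one, ← Equiv.symm_apply_eq]
    have : past.symm (fun j : {j // j < blockEquiv n (1, i)} => joinEquiv n (ZMod 2) (u, v) j) =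
        (encode n u, fun j : {j // j < i} => v j) :=
      Prod.ext (congrArg (encode n) (funext fun k => joinEquiv_zero u v k))
        (funext fun j => joinEquiv_one u v j)
    rw [this, Prod.mk.injEq, show encode n u = (fun k => (z k).2) ↔
      u = encode n (fun k => (z k).2) from (encodeEquiv n).eq_symm_apply.symm]
    tauto
  change W.bitDensity (n + 1) (blockEquiv n (1, i)) b
    (joinEquiv n Y (fun k => (z k).1.1, fun k => (z k).1.2), past (fun k => (z k).2, q)) = _
  simp only [bitChannel, bitDensity]
  rw [Finset.sum_filter, Finset.sum_filter, sum_joinEquiv, normalization_succ, mul_assoc]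
  congr 1
  simp only [hcond, prod_joinEquiv, ite_and]
  rw [Finset.sum_eq_single (encode n fun k => (z k).2) (fun u _ hu => by simp [hu]) (by simp),
    Finset.mul_sum]
  refine Finset.sum_congr rfl fun v _ => ?_
  simp only [if_true, encode_encode]
  split_ifs
  · simp only [plus, Finset.prod_div_distrib, Finset.prod_const, Finset.card_univ,
      Fintype.card_fin]
    rw [div_eq_inv_mul]
  all_goals simp

theorem bhattacharyya_bitChannel_zero (W : BinaryChannel Y) (i : Fin (2 ^ 0)) :
    (W.bitChannel 0 i).bhattacharyya = W.bhattacharyya := by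
  have hi : IsEmpty {j : Fin (2 ^ 0) // j < i} :=
    ⟨fun j => by have := j.2; have := i.2; have := j.1.2; rw [Fin.lt_def] at *; omega⟩
  have : Subsingleton (Fin (2 ^ 0)) := inferInstanceAs (Subsingleton (Fin 1))
  let _ : Unique (Fin (2 ^ 0)) := inferInstanceAs (Unique (Fin 1))
  have h1 : MeasurePreserving (fun y : Y => fun _ : Fin (2 ^ 0) => y) W.ref
      (Measure.pi fun _ => W.ref) := (measurePreserving_funUnique W.ref (Fin (2 ^ 0))).symm
  have h2 : (Measure.count : Measure ({j : Fin (2 ^ 0) // j < i} → ZMod 2)) =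
      Measure.dirac default := by
    refine Measure.ext_of_singleton fun x => ?_
    rw [Subsingleton.elim x default]
    simp
  have h3 : MeasurePreserving
      (fun y : Fin (2 ^ 0) → Y => (y, (default : {j : Fin (2 ^ 0) // j < i} → ZMod 2)))
      (Measure.pi fun _ => W.ref) ((Measure.pi fun _ => W.ref).prod Measure.count) :=
    ⟨measurable_prodMk_right, by rw [h2, Measure.prod_dirac]⟩
  refine bhattacharyya_eq_of_measurePreserving _ (h3.comp h1) fun b y => ?_
  simp only [bitChannel, bitDensity, Function.comp]
  have hfilter : (Finset.univ.filter fun u : Fin (2 ^ 0) → ZMod 2 => u i = b ∧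
      (fun j : {j : Fin (2 ^ 0) // j < i} => u j) = default) = {fun _ => b} := by
    ext u
    simp only [Finset.mem_filter, Finset.mem_univ, true_and, Finset.mem_singleton]
    constructor
    · rintro ⟨h, -⟩
      exact funext fun k => by rw [Subsingleton.elim k i, h]
    · rintro rfl
      exact ⟨rfl, Subsingleton.elim _ _⟩
  rw [hfilter]
  simp [encode, encodingMatrix]

end BinaryChannel

/-! ### Strict order relations between bit-channels -/

namespace BinaryChannel

universe u v

/-- Strict comparison passes to the bit-channels, because it is preserved by both transforms. -/
theorem StrictlyWorse.bitChannel_lt (n : ℕ) : ∀ {Y₁ : Type u} {Y₂ : Type v} [MeasurableSpace Y₁]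
    [MeasurableSpace Y₂] {W₁ : BinaryChannel Y₁} {W₂ : BinaryChannel Y₂}, W₁.StrictlyWorse W₂ →
    W₁.Nondegenerate → ∀ i : Fin (2 ^ n),
      (W₂.bitChannel n i).bhattacharyya < (W₁.bitChannel n i).bhattacharyya := by
  induction n with
  | zero =>
    intro Y₁ Y₂ _ _ W₁ W₂ h _ i
    rw [bhattacharyya_bitChannel_zero, bhattacharyya_bitChannel_zero]
    exact h.bhattacharyya_lt
  | succ n ih =>
    intro Y₁ Y₂ _ _ W₁ W₂ h h₁ i
    obtain ⟨⟨a, i⟩, rfl⟩ := (blockEquiv n).surjective i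
    fin_cases a
    · simp only [Fin.zero_eta]
      rw [bhattacharyya_bitChannel_minus, bhattacharyya_bitChannel_minus]
      exact ih (h.minus h₁) h₁.minus _
    · simp only [Fin.mk_one]
      rw [bhattacharyya_bitChannel_plus, bhattacharyya_bitChannel_plus]
      exact ih (h.plus h₁) h₁.plus _

theorem testBit_blockEquiv_zero {n : ℕ} (i : Fin (2 ^ n)) (p : ℕ) :
    (blockEquiv n (0, i) : ℕ).testBit p = (i : ℕ).testBit p := by
  rw [blockEquiv_val]; simp

theorem testBit_blockEquiv_one {n : ℕ} (i : Fin (2 ^ n)) (p : ℕ) :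
    (blockEquiv n (1, i) : ℕ).testBit p = (decide (p = n) || (i : ℕ).testBit p) := by
  rw [blockEquiv_val, Fin.val_one, mul_one, testBit_add_two_pow (Nat.testBit_lt_two_pow i.2)]

theorem eq_blockEquiv_add {n : ℕ} {a : Fin 2} {i : Fin (2 ^ n)} {j : Fin (2 ^ (n + 1))} {p : ℕ}
    (hlt : (i : ℕ) + 2 ^ p < 2 ^ n) (hj : (j : ℕ) = blockEquiv n (a, i) + 2 ^ p) :
    j = blockEquiv n (a, ⟨i + 2 ^ p, hlt⟩) := by
  refine Fin.ext ?_
  rw [hj, blockEquiv_val, blockEquiv_val]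
  simp only
  ring

/-- Turning a digit `0` into `1` replaces a transform `W⁻` by `W⁺`. -/
theorem Nondegenerate.bhattacharyya_flip_lt (n : ℕ) : ∀ {Y : Type u} [MeasurableSpace Y]
    {W : BinaryChannel Y}, W.Nondegenerate → ∀ (i j : Fin (2 ^ n)) (p : ℕ),
      (i : ℕ).testBit p = false → (j : ℕ) = i + 2 ^ p →
      (W.bitChannel n j).bhattacharyya < (W.bitChannel n i).bhattacharyya := by
  induction n with
  | zero =>
    intro Y _ W _ i j p _ hj
    have : 0 < 2 ^ p := by positivity
    have : (j : ℕ) < 1 := j.2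
    omega
  | succ n ih =>
    intro Y _ W hW i j p hb hj
    have hpn : p < n + 1 := (Nat.pow_lt_pow_iff_right (a := 2) (by norm_num)).1 (by omega)
    obtain ⟨⟨a, i⟩, rfl⟩ := (blockEquiv n).surjective i
    rcases Nat.lt_succ_iff_lt_or_eq.1 hpn with hp | rfl
    · have hbi : (i : ℕ).testBit p = false := by
        fin_cases a
        · simpa [testBit_blockEquiv_zero] using hb
        · simpa [testBit_blockEquiv_one, hp.ne] using hb
      have hlt := add_two_pow_lt i.2 hp hbi
      obtain rfl := eq_blockEquiv_add hlt hj
      fin_cases a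
      · simp only [Fin.zero_eta]
        rw [bhattacharyya_bitChannel_minus, bhattacharyya_bitChannel_minus]
        exact ih hW.minus _ _ p hbi rfl
      · simp only [Fin.mk_one]
        rw [bhattacharyya_bitChannel_plus, bhattacharyya_bitChannel_plus]
        exact ih hW.plus _ _ p hbi rfl
    · fin_cases a
      · simp only [Fin.zero_eta] at *
        obtain rfl : j = blockEquiv p (1, i) := Fin.ext (by rw [hj]; simp [blockEquiv_val])
        rw [bhattacharyya_bitChannel_minus, bhattacharyya_bitChannel_plus]
        exact hW.minus_strictlyWorse_plus.bitChannel_lt p hW.minus i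
      · simp [testBit_blockEquiv_one] at hb

/-- Moving a digit `1` one place up replaces the transforms `W⁻⁺` by `W⁺⁻`. -/
theorem Nondegenerate.bhattacharyya_shift_lt (n : ℕ) : ∀ {Y : Type u} [MeasurableSpace Y]
    {W : BinaryChannel Y}, W.Nondegenerate → ∀ (i j : Fin (2 ^ n)) (p : ℕ),
      (i : ℕ).testBit p = true → (i : ℕ).testBit (p + 1) = false → (j : ℕ) = i + 2 ^ p →
      (W.bitChannel n j).bhattacharyya < (W.bitChannel n i).bhattacharyya := by
  induction n with
  | zero =>
    intro Y _ W _ i j p _ _ hj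
    have : 0 < 2 ^ p := by positivity
    have : (j : ℕ) < 1 := j.2
    omega
  | succ n ih =>
    intro Y _ W hW i j p hb hb' hj
    have hpn : p + 1 < n + 1 := by
      obtain ⟨s, -, -, -, hsum⟩ := exists_eq_add_two_pow hb hb'
      exact (Nat.pow_lt_pow_iff_right (a := 2) (by norm_num)).1 (by omega)
    obtain ⟨⟨a, i⟩, rfl⟩ := (blockEquiv n).surjective i
    rcases Nat.lt_succ_iff_lt_or_eq.1 hpn with hp | rfl
    · have hbi : (i : ℕ).testBit p = true ∧ (i : ℕ).testBit (p + 1) = false := by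
        fin_cases a
        · simpa [testBit_blockEquiv_zero] using And.intro hb hb'
        · simpa [testBit_blockEquiv_one, hp.ne, show p ≠ n by omega] using And.intro hb hb'
      have hlt := add_two_pow_lt_of_shift i.2 hp hbi.1 hbi.2
      obtain rfl := eq_blockEquiv_add hlt hj
      fin_cases a
      · simp only [Fin.zero_eta]
        rw [bhattacharyya_bitChannel_minus, bhattacharyya_bitChannel_minus]
        exact ih hW.minus _ _ p hbi.1 hbi.2 rfl
      · simp only [Fin.mk_one]
        rw [bhattacharyya_bitChannel_plus, bhattacharyya_bitChannel_plus]
        exact ih hW.plus _ _ p hbi.1 hbi.2 rfl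
    · -- the two leading digits are `01` and become `10`
      obtain ⟨⟨a', i⟩, rfl⟩ := (blockEquiv p).surjective i
      have ha : a = 0 := by
        fin_cases a
        · rfl
        · simp [testBit_blockEquiv_one] at hb'
      subst ha
      have ha' : a' = 1 := by
        fin_cases a'
        · rw [testBit_blockEquiv_zero] at hb
          simp [testBit_blockEquiv_zero, Nat.testBit_lt_two_pow i.2] at hb
        · rfl
      subst ha'
      obtain rfl : j = blockEquiv (p + 1) (1, blockEquiv p (0, i)) := Fin.ext (by
        rw [hj]; simp [blockEquiv_val, pow_succ]; ring)
      rw [bhattacharyya_bitChannel_minus, bhattacharyya_bitChannel_plus,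
        bhattacharyya_bitChannel_minus, bhattacharyya_bitChannel_plus]
      exact hW.minus_plus_strictlyWorse_plus_minus.bitChannel_lt p hW.minus.plus i

/-- By strictness, ties between Bhattacharyya parameters do not matter. -/
theorem Nondegenerate.moveClosed {Y : Type u} [MeasurableSpace Y] {W : BinaryChannel Y}
    (hW : W.Nondegenerate) {n : ℕ} {A : Finset (Fin (2 ^ n))} (hA : W.IsInformationSet n A) :
    MoveClosed A where
  flip i hi j p hb hj := by
    by_contra hjA
    exact (hW.bhattacharyya_flip_lt n i j p hb hj).not_ge (hA i hi j hjA)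
  shift i hi j p hb hb' hj := by
    by_contra hjA
    exact (hW.bhattacharyya_shift_lt n i j p hb hb' hj).not_ge (hA i hi j hjA)

end BinaryChannel

end Polar

end

theorem corollaryc1 {Y : Type*} [MeasurableSpace Y] (W : Polar.BinaryChannel Y)
    (hsymm : W.IsSymmetric) (hpos : 0 < W.bhattacharyya) (hlt : W.bhattacharyya < 1)
    (n : ℕ) (A : Finset (Fin (2 ^ n))) (hA : A.Nonempty) (hinfo : W.IsInformationSet n A) :
    (∃ V, Polar.IsMVSS A V) ∧
      ∀ V, Polar.IsMVSS A V → V.card = A.inf' hA Polar.leafCount :=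
  ((Polar.BinaryChannel.Nondegenerate.of_bhattacharyya hpos hlt).moveClosed hinfo).isMVSS hA
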